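/- **Theorem 4.1 (Functional convergence in $M_1$).** Let $D=D([0,\infty),\mathbb R^d)$ be the space of càdlàg paths with the usual (local) Skorokhod $J_1$ topology, let $\mathcal H=C([0,\infty)\times\mathbb R^d,\mathbb R)$ with the topology of uniform convergence on compacts, and let $D\times\mathcal H$ carry the product topology. For $y:[0,\infty)\to\mathbb R$ and $u\in\mathbb R$ put $T_y(u)=\inf\{t\ge 0: y(t)\ge u\}\in[0,\infty]$ (with $\inf\varnothing=\infty$). A level $u$ is called *regular* for $y$ if $T_y(u)<\infty$ and $\sup_{s\in[T_y(u),T_y(u)+\varepsilon]}(y(s)-u)>0$ for every $\varepsilon>0$. Let $u_0<u_1$ be rational. Let $(X_n,\Phi_n)$ and $(X,\Phi)$ be random elements of $D\times\mathcal H$, possibly on different probability spaces, and put $Y_n(t)=\Phi_n(t,X_n(t))$, $Y(t)=\Phi(t,X(t))$, $\tau_n(u)=T_{Y_n}(u)$, $\tau(u)=T_Y(u)$. Assume $(X_n,\Phi_n)\Rightarrow(X,\Phi)$ in $D\times\mathcal H$ and 1. $\tau(u_1)<\infty$ almost surely; 2. almost surely, every $u\in\mathbb Q\cap[u_0,u_1]$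 is regular for $Y$; 3. almost surely, for $v\in\{u_0,u_1\}$ and every $T\in[0,\infty)$ with $T<\tau(v)$, one has $\sup_{0\le s\le T}Y(s)<v$. Then $\mathbb P(\tau_n(u_1)=\infty)\to 0$, and $\tau_n(\cdot)\Rightarrow\tau(\cdot)$ in $D([u_0,u_1],\mathbb R)$ with the Skorokhod $M_1$ topology. Here a profile $\sigma\in\{\tau_n,\tau\}$ with $\sigma(u_1)<\infty$ is identified with its right-continuous modification on $[u_0,u_1]$, namely $u\mapsto\inf_{u<v\le u_1}\sigma(v)$ for $u<u_1$ with value $\sigma(u_1)$ at $u_1$; on the event $\{\sigma(u_1)=\infty\}$ it is replaced by a fixed element of $D([u_0,u_1],\mathbb R)$, and the conclusion holds for every choice of this element. Moreover, the $J_1$ topology on profiles would be too strong. Let $y=0$ on $[0,1)$, $y=\tfrac12$ on $[1,2)$, $y=1$ on $[2,\infty)$. For $n\ge1$ let $y_n=0$ on $[0,1)$, $y_n=\tfrac12+\tfrac{k}{n^2}$ on $[1+\tfrac kn,1+\tfrac{k+1}n)$ for $k=0,\dots,n-1$, and $y_n=1$ on $[2,\infty)$. Then $y_n\to y$ uniformly,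 and the (right-continuous) profiles $T_{y_n}$ converge to $T_y$ in $D([\tfrac14,\tfrac34],\mathbb R)$ for $M_1$ but not for $J_1$. -/

import Mathlib

open Set Filter Topology MeasureTheory
open scoped NNReal ENNReal

namespace ExitProfile

/-! ## Càdlàg functions and the Skorokhod `J₁` topology -/

/-- `f` is right-continuous with left limits. (At a least point the left limit is vacuous, at a
greatest point right-continuity is vacuous.) -/
def IsCadlag {ι E : Type*} [LinearOrder ι] [TopologicalSpace ι] [TopologicalSpace E]
    (f : ι → E) : Prop :=
  ∀ t, ContinuousWithinAt f (Ioi t) t ∧ ∃ l, Tendsto f (𝓝[<] t) (𝓝 l)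

/-- The space `D(ι, E)` of càdlàg functions from `ι` to `E`. -/
structure Cadlag (ι E : Type*) [LinearOrder ι] [TopologicalSpace ι] [TopologicalSpace E] where
  toFun : ι → E
  isCadlag : IsCadlag toFun

instance {ι E : Type*} [LinearOrder ι] [TopologicalSpace ι] [TopologicalSpace E] :
    CoeFun (Cadlag ι E) (fun _ => ι → E) := ⟨Cadlag.toFun⟩

/-- Basic `J₁` neighbourhood of `x`: after an increasing homeomorphism `l` of the index set, which
is `ε`-close to the identity on `K`, the path `y` is uniformly `ε`-close to `x` on `K`. -/
def j1Nhd {ι E : Type*} [LinearOrder ι] [PseudoMetricSpace ι] [PseudoMetricSpace E]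
    (x : Cadlag ι E) (K : Set ι) (ε : ℝ) : Set (Cadlag ι E) :=
  {y | ∃ l : ι ≃o ι, ∀ t ∈ K, dist (l t) t < ε ∧ dist (y (l t)) (x t) < ε}

/-- The Skorokhod `J₁` topology. A set is open if with each path `x` it contains a basic
neighbourhood of `x` over some compact set of indices. For `ι = [0, ∞)` this is the usual local
`J₁` topology: `yₙ → x` iff for all `T, ε > 0`, for large `n`, some increasing homeomorphism `l` of
`[0, ∞)` has `|l t - t| < ε` and `dist (yₙ (l t)) (x t) < ε` for all `t ≤ T`. For `ι = [a, b]` one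
may take `K = [a, b]`, which gives the `J₁` topology of `D([a, b], E)`. -/
@[reducible] def j1Topology (ι E : Type*) [LinearOrder ι] [PseudoMetricSpace ι] [PseudoMetricSpace E] :
    TopologicalSpace (Cadlag ι E) where
  IsOpen U := ∀ x ∈ U, ∃ K : Set ι, IsCompact K ∧ ∃ ε > 0, j1Nhd x K ε ⊆ U
  isOpen_univ _ _ := ⟨∅, isCompact_empty, 1, one_pos, subset_univ _⟩
  isOpen_inter := by
    intro U V hU hV x hx
    obtain ⟨K, hK, ε, hε, h⟩ := hU x hx.1
    obtain ⟨L, hL, δ, hδ, h'⟩ := hV x hx.2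
    refine ⟨K ∪ L, hK.union hL, min ε δ, lt_min hε hδ, ?_⟩
    rintro y ⟨l, hl⟩
    refine ⟨h ⟨l, fun t ht => ?_⟩, h' ⟨l, fun t ht => ?_⟩⟩
    · have := hl t (Or.inl ht)
      exact ⟨this.1.trans_le (min_le_left _ _), this.2.trans_le (min_le_left _ _)⟩
    · have := hl t (Or.inr ht)
      exact ⟨this.1.trans_le (min_le_right _ _), this.2.trans_le (min_le_right _ _)⟩
  isOpen_sUnion := by
    intro S hS x hx
    obtain ⟨U, hU, hxU⟩ := hx
    obtain ⟨K, hK, ε, hε, h⟩ := hS U hU x hxU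
    exact ⟨K, hK, ε, hε, h.trans (subset_sUnion_of_mem hU)⟩

/-! ## The Skorokhod `M₁` topology on `D([a, b], ℝ)` -/

/-- The completed graph of `f`: all `(t, z)` with `z` in the segment between `f(t-)` and `f(t)`,
where `f(a-) = f(a)`. -/
def completedGraph {a b : ℝ} (f : Cadlag (Icc a b) ℝ) : Set (Icc a b × ℝ) :=
  {p | p.2 ∈ uIcc (Function.leftLim f p.1) (f p.1)}

/-- The natural order on the completed graph: by the first coordinate, and on a vertical segment
by the distance from the left limit. -/
def graphLE {a b : ℝ} (f : Cadlag (Icc a b) ℝ) (p q : Icc a b × ℝ) : Prop :=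
  p.1 < q.1 ∨ (p.1 = q.1 ∧ |p.2 - Function.leftLim f p.1| ≤ |q.2 - Function.leftLim f p.1|)

/-- `(r, z)` is a parametric representation of `f`: a continuous map of `[0, 1]` onto the completed
graph, nondecreasing for its natural order. -/
structure IsParamRep {a b : ℝ} (f : Cadlag (Icc a b) ℝ) (r : unitInterval → Icc a b)
    (z : unitInterval → ℝ) : Prop where
  continuous_fst : Continuous r
  continuous_snd : Continuous z
  range_eq : range (fun s => (r s, z s)) = completedGraph f
  mono : ∀ s s', s ≤ s' → graphLE f (r s, z s) (r s', z s')

/-- The `M₁` ball around `f`: those `g` for which some parametric representations of `f` and `g`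
are uniformly `ε`-close. -/
def m1Ball {a b : ℝ} (f : Cadlag (Icc a b) ℝ) (ε : ℝ) : Set (Cadlag (Icc a b) ℝ) :=
  {g | ∃ r z r' z', IsParamRep f r z ∧ IsParamRep g r' z' ∧
    ∃ δ < ε, ∀ s, |(r s : ℝ) - r' s| ≤ δ ∧ |z s - z' s| ≤ δ}

/-- The Skorokhod `M₁` topology on `D([a, b], ℝ)`, the topology of the metric
`inf max (‖r - r'‖, ‖z - z'‖)` over the parametric representations of the two functions. -/
@[reducible] def m1Topology (a b : ℝ) : TopologicalSpace (Cadlag (Icc a b) ℝ) where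
  IsOpen U := ∀ f ∈ U, ∃ ε > 0, m1Ball f ε ⊆ U
  isOpen_univ _ _ := ⟨1, one_pos, subset_univ _⟩
  isOpen_inter := by
    intro U V hU hV f hf
    obtain ⟨ε, hε, h⟩ := hU f hf.1
    obtain ⟨δ, hδ, h'⟩ := hV f hf.2
    refine ⟨min ε δ, lt_min hε hδ, ?_⟩
    rintro g ⟨r, z, r', z', h1, h2, c, hc, h3⟩
    exact ⟨h ⟨r, z, r', z', h1, h2, c, hc.trans_le (min_le_left _ _), h3⟩,
      h' ⟨r, z, r', z', h1, h2, c, hc.trans_le (min_le_right _ _), h3⟩⟩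
  isOpen_sUnion := by
    intro S hS f hf
    obtain ⟨U, hU, hfU⟩ := hf
    obtain ⟨ε, hε, h⟩ := hS U hU f hfU
    exact ⟨ε, hε, h.trans (subset_sUnion_of_mem hU)⟩

/-! ## Weak convergence -/

/-- Weak convergence of the random elements `Z n` to `W` in the topological space `(E, 𝒯)` with its
Borel σ-algebra: convergence in distribution, including (a.e.) Borel measurability of `Z n`, `W`. -/
def ConvergesWeakly {E : Type*} (𝒯 : TopologicalSpace E) {Ω : ℕ → Type*} {Ω' : Type*}
    [∀ n, MeasurableSpace (Ω n)] [MeasurableSpace Ω']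
    (P : ∀ n, Measure (Ω n)) [∀ n, IsProbabilityMeasure (P n)]
    (P' : Measure Ω') [IsProbabilityMeasure P']
    (Z : ∀ n, Ω n → E) (W : Ω' → E) : Prop :=
  letI := 𝒯
  letI : MeasurableSpace E := borel E
  haveI : BorelSpace E := ⟨rfl⟩
  TendstoInDistribution Z atTop W P P'

/-! ## Paths, barriers, first passage -/

/-- Càdlàg paths `[0, ∞) → ℝᵈ`. -/
abbrev Path (d : ℕ) : Type := Cadlag ℝ≥0 (EuclideanSpace ℝ (Fin d))

/-- Barriers: continuous real functions on `[0, ∞) × ℝᵈ`, with the compact-open topology, that is,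
locally uniform convergence on compacts. -/
abbrev Barrier (d : ℕ) : Type := C(ℝ≥0 × EuclideanSpace ℝ (Fin d), ℝ)

/-- The product of the local `J₁` topology on paths and the locally uniform one on barriers. -/
@[reducible] noncomputable def pathBarrierTopology (d : ℕ) : TopologicalSpace (Path d × Barrier d) :=
  @instTopologicalSpaceProd _ _ (j1Topology ℝ≥0 (EuclideanSpace ℝ (Fin d))) inferInstance

/-- The scalar path `t ↦ Φ(t, x(t))`. -/
def scalarPath {d : ℕ} (x : Path d) (Φ : Barrier d) : ℝ≥0 → ℝ := fun t => Φ (t, x t)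

/-- First-passage time `T_y(u) = inf {t ≥ 0 : y(t) ≥ u}`, with `inf ∅ = ∞`. -/
noncomputable def passageTime (y : ℝ≥0 → ℝ) (u : ℝ) : ℝ≥0∞ :=
  ⨅ (t : ℝ≥0) (_ : u ≤ y t), (t : ℝ≥0∞)

/-- `u` is a regular level of `y`: `T_y(u) < ∞` and
`sup {y(s) - u : T_y(u) ≤ s ≤ T_y(u) + ε} > 0` for every `ε > 0`. -/
def IsRegularLevel (y : ℝ≥0 → ℝ) (u : ℝ) : Prop :=
  passageTime y u < ∞ ∧
    ∀ ε : ℝ≥0, 0 < ε → ∃ s : ℝ≥0, passageTime y u ≤ s ∧ s ≤ passageTime y u + ε ∧ u < y s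

/-- Strict separation from the level `u` before first passage: `sup {y(s) : s ≤ T} < u` for every
`T < T_y(u)`. -/
def IsSeparatedBefore (y : ℝ≥0 → ℝ) (u : ℝ) : Prop :=
  ∀ T : ℝ≥0, (T : ℝ≥0∞) < passageTime y u → ∃ c < u, ∀ s ≤ T, y s ≤ c

lemma passageTime_mono (y : ℝ≥0 → ℝ) : Monotone (passageTime y) := fun _ _ h =>
  le_iInf₂ fun t ht => iInf₂_le t (h.trans ht)

lemma isCadlag_rightLim {a b : ℝ} {f : Icc a b → ℝ} (hf : Monotone f) :
    IsCadlag (Function.rightLim f) := fun t =>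
  ⟨(continuousWithinAt_rightLim_Ici (hf.tendsto_rightLim t)).mono Ioi_subset_Ici_self,
    _, hf.rightLim.tendsto_leftLim t⟩

lemma monotone_toReal_passageTime {a b : ℝ} {y : ℝ≥0 → ℝ} (h : passageTime y b ≠ ∞) :
    Monotone fun u : Icc a b => (passageTime y u).toReal := fun _ v huv =>
  ENNReal.toReal_mono (ne_top_of_le_ne_top h (passageTime_mono y v.2.2))
    (passageTime_mono y huv)

open Classical in
/-- The exit-time profile of `y` on `[a, b]` as an element of `D([a, b], ℝ)`: the right-continuous
modification of `u ↦ T_y(u)` on `[a, b]`, with value `inf {T_y(v) : u < v ≤ b}` at `u < b` and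
`T_y(b)` at `b`. If `T_y(b) = ∞` there is no real-valued profile, and the placeholder `z` is
returned. -/
noncomputable def exitProfile {a b : ℝ} (z : Cadlag (Icc a b) ℝ) (y : ℝ≥0 → ℝ) :
    Cadlag (Icc a b) ℝ :=
  if h : passageTime y b ≠ ∞ then
    ⟨Function.rightLim fun u : Icc a b => (passageTime y u).toReal,
      isCadlag_rightLim (monotone_toReal_passageTime h)⟩
  else z

/-! ## Explicit paths for which `J₁` convergence of the profiles fails -/

/-- `0` on `[0, 1)`, `1/2` on `[1, 2)`, `1` on `[2, ∞)`. -/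
noncomputable def stepPath (t : ℝ≥0) : ℝ :=
  if t < 1 then 0 else if t < 2 then 1 / 2 else 1

/-- `0` on `[0, 1)`, `1/2 + k/n²` on `[1 + k/n, 1 + (k+1)/n)` for `k = 0, …, n - 1`, and `1` on
`[2, ∞)` (used for `n ≥ 1`). -/
noncomputable def stairPath (n : ℕ) (t : ℝ≥0) : ℝ :=
  if t < 1 then 0 else if t < 2 then 1 / 2 + (⌊(n : ℝ) * ((t : ℝ) - 1)⌋₊ : ℝ) / (n : ℝ) ^ 2 else 1

end ExitProfile

/-! The profile is monotone in the level, and near a monotone function $M_1$ is coarser, on monotone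
functions, than pointwise convergence on a dense set of levels containing both end points
(`exists_isOpen_forall_mem_m1Ball`). To see this, parametrize each completed graph affinely by the
sum of its two coordinates; closeness on a fine finite grid then makes the two parametrizations
uniformly close.

Pointwise convergence rests on two stability properties of $(x,\Phi)\mapsto\Phi(\cdot,x(\cdot))$.
Exceeding a level somewhere in an open set of times is an open condition
(`isOpen_exists_lt_scalarPath`), which bounds nearby profiles from above. Staying strictly below a
level up to a time persists after shrinking that time (`eventually_forall_scalarPath_lt`), which
bounds them from below. At the two end levels, regularity and separation turn these into
convergence. At an interior level it is enough that $u\mapsto T_y(u)$ be continuous there, which by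
monotonicity fails for only countably many levels. Hence the profile map is continuous at almost
every value of the limit.

A mapping theorem (`TendstoInDistribution.comp_of_ae_continuousAt`) then gives weak convergence. It
needs a pseudometrizable source, obtained from a countable base of entourages for $J_1$, and a
profile map measurable for every finite Borel measure (`aemeasurable_exitProfile`).

In the example, the same deterministic criterion gives $M_1$ convergence. $J_1$ convergence fails
because a bijective change of levels preserves the set of values, and the stair profiles take values
well inside the jump of the limit. -/

namespace ExitProfile

/-! ## `M₁` neighbourhoods of monotone functions -/

section Monotone

variable {a b : ℝ}

/-- Along the graph of a monotone function the sum of the coordinates increases strictly. -/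
lemma add_lt_add_leftLim {f : Icc a b → ℝ} (hf : Monotone f) {t t' : Icc a b} (h : t < t') :
    (t : ℝ) + f t < t' + Function.leftLim f t' :=
  add_lt_add_of_lt_of_le h (hf.le_leftLim h)

/-- Every value between the sums of coordinates at the end points is the sum of the coordinates of
a point of the completed graph. -/
lemma exists_add_leftLim_le (hab : a ≤ b) (f : Cadlag (Icc a b) ℝ) (hf : Monotone f) {s : ℝ}
    (h0 : a + f ⟨a, left_mem_Icc.2 hab⟩ ≤ s) (h1 : s ≤ b + f ⟨b, right_mem_Icc.2 hab⟩) :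
    ∃ t : Icc a b, (t : ℝ) + Function.leftLim f t ≤ s ∧ s ≤ t + f t := by
  -- The required point is the last level at which $t+f(t)\le s$: the left limit inherits this
  -- bound, and right-continuity forbids $t+f(t)<s$ there.
  set A : Set ℝ := {x | ∃ h : x ∈ Icc a b, x + f ⟨x, h⟩ ≤ s} with hA
  have haA : a ∈ A := ⟨left_mem_Icc.2 hab, h0⟩
  have hbdd : BddAbove A := ⟨b, fun x hx => hx.1.2⟩
  have hmem : sSup A ∈ Icc a b := ⟨le_csSup hbdd haA, csSup_le ⟨a, haA⟩ fun x hx => hx.1.2⟩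
  set r : Icc a b := ⟨sSup A, hmem⟩ with hr
  have hlt : ∀ t : Icc a b, t < r → (t : ℝ) + f t ≤ s := by
    intro t ht
    obtain ⟨x, hx, htx⟩ := exists_lt_of_lt_csSup ⟨a, haA⟩ (show (t : ℝ) < sSup A from ht)
    have : f t ≤ f ⟨x, hx.1⟩ := hf (show t ≤ ⟨x, hx.1⟩ from htx.le)
    have := hx.2
    linarith
  refine ⟨r, ?_, ?_⟩
  · rcases eq_or_lt_of_le (show (⟨a, left_mem_Icc.2 hab⟩ : Icc a b) ≤ r from hmem.1) with h | h
    · rw [← h, leftLim_eq_of_isBot (fun t => t.2.1)]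
      exact h0
    · have : (𝓝[<] r).NeBot := nhdsLT_neBot_of_exists_lt ⟨_, h⟩
      have hc : Tendsto (fun t : Icc a b => (t : ℝ) + f t) (𝓝[<] r)
          (𝓝 ((r : ℝ) + Function.leftLim f r)) :=
        ((continuous_subtype_val.tendsto r).mono_left nhdsWithin_le_nhds).add
          (hf.tendsto_leftLim r)
      exact le_of_tendsto hc (eventually_nhdsWithin_of_forall hlt)
  · by_contra! hcon
    have hrb : r < ⟨b, right_mem_Icc.2 hab⟩ := by
      refine lt_of_le_of_ne hmem.2 fun h => ?_
      rw [h] at hcon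
      exact absurd h1 (not_le.2 hcon)
    have : (𝓝[>] r).NeBot := nhdsGT_neBot_of_exists_gt ⟨_, hrb⟩
    have hc : Tendsto (fun t : Icc a b => (t : ℝ) + f t) (𝓝[>] r) (𝓝 ((r : ℝ) + f r)) :=
      ((continuous_subtype_val.tendsto r).mono_left nhdsWithin_le_nhds).add
        (f.isCadlag r).1
    obtain ⟨t, ht, htr⟩ := ((hc.eventually_lt_const hcon).and self_mem_nhdsWithin).exists
    have : (t : ℝ) ≤ sSup A := le_csSup hbdd ⟨t.2, ht.le⟩
    exact absurd (show r < t from htr) (not_lt.2 this)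

lemma mem_completedGraph_iff {f : Cadlag (Icc a b) ℝ} (hf : Monotone f) {p : Icc a b × ℝ} :
    p ∈ completedGraph f ↔ Function.leftLim f p.1 ≤ p.2 ∧ p.2 ≤ f p.1 := by
  rw [completedGraph, mem_ofPred_eq, uIcc_of_le (hf.leftLim_le le_rfl), mem_Icc]

/-- A monotone function has the parametric representation whose sum of coordinates is affine. -/
lemma exists_isParamRep (hab : a < b) (f : Cadlag (Icc a b) ℝ) (hf : Monotone f) :
    ∃ r z, IsParamRep f r z ∧ ∀ σ : unitInterval, (r σ : ℝ) + z σ =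
      (1 - (σ : ℝ)) * (a + f ⟨a, left_mem_Icc.2 hab.le⟩)
        + σ * (b + f ⟨b, right_mem_Icc.2 hab.le⟩) := by
  set p := a + f ⟨a, left_mem_Icc.2 hab.le⟩ with hp
  set q := b + f ⟨b, right_mem_Icc.2 hab.le⟩ with hq
  have hpq : p < q := add_lt_add_of_lt_of_le hab (hf hab.le)
  have hs : ∀ σ : unitInterval, p ≤ (1 - (σ : ℝ)) * p + σ * q ∧
      (1 - (σ : ℝ)) * p + σ * q ≤ q := by
    intro σ
    have h0 := σ.2.1
    have h1 := σ.2.2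
    constructor <;> nlinarith
  choose r hr1 hr2 using fun σ : unitInterval =>
    exists_add_leftLim_le hab.le f hf (hs σ).1 (hs σ).2
  set S : unitInterval → ℝ := fun σ => (1 - (σ : ℝ)) * p + σ * q with hS
  have hSmono : Monotone S := by
    intro σ σ' h
    have : (σ : ℝ) ≤ σ' := h
    simp only [hS]
    nlinarith
  have hScont : Continuous S := by fun_prop
  have hrm : Monotone r := by
    intro σ σ' h
    by_contra! hcon
    have := add_lt_add_leftLim hf hcon
    have h1 := hSmono h
    have h2 := hr1 σ
    have h3 := hr2 σ'
    simp only [hS] at h1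
    linarith
  have hzm : Monotone fun σ => S σ - r σ := by
    intro σ σ' h
    have h1 := hSmono h
    have h2 := hr1 σ'
    have h3 := hr2 σ
    rcases (hrm h).eq_or_lt with h' | h'
    · simp only [h']; linarith
    · have := hf.le_leftLim h'
      simp only [hS]; linarith
  -- Both `r` and `S - r` are nondecreasing with continuous sum `S`, so increments of `r` are
  -- dominated by those of `S`.
  have hrc : Continuous fun σ => (r σ : ℝ) := by
    refine continuous_iff_continuousAt.2 fun σ => ?_
    refine tendsto_iff_dist_tendsto_zero.2 ?_
    refine squeeze_zero (fun _ => dist_nonneg) (g := fun σ' => dist (S σ') (S σ)) ?_ ?_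
    · intro σ'
      rw [Real.dist_eq, Real.dist_eq]
      rcases le_total σ σ' with h | h
      · have h1 : (r σ : ℝ) ≤ r σ' := hrm h
        have h2 := hzm h
        have h3 := hSmono h
        simp only at h2
        rw [abs_of_nonneg (by linarith), abs_of_nonneg (by linarith)]
        linarith
      · have h1 : (r σ' : ℝ) ≤ r σ := hrm h
        have h2 := hzm h
        have h3 := hSmono h
        simp only at h2
        rw [abs_of_nonpos (by linarith), abs_of_nonpos (by linarith)]
        linarith
    · exact tendsto_iff_dist_tendsto_zero.1 hScont.continuousAt
  refine ⟨r, fun σ => S σ - r σ, ⟨hrc.subtype_mk _, hScont.sub hrc, ?_, ?_⟩, fun σ => by simp [hS]⟩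
  · apply Subset.antisymm
    · rintro _ ⟨σ, rfl⟩
      rw [mem_completedGraph_iff hf]
      have := hr1 σ
      have := hr2 σ
      simp only [hS]
      constructor <;> linarith
    · rintro ⟨t, z⟩ htz
      rw [mem_completedGraph_iff hf] at htz
      simp only at htz
      have h1 : p ≤ t + z := by
        rcases eq_or_lt_of_le (show (⟨a, left_mem_Icc.2 hab.le⟩ : Icc a b) ≤ t from t.2.1) with h | h
        · have := htz.1
          rw [← h, leftLim_eq_of_isBot (fun t => t.2.1)] at this
          rw [← h]
          simp only [hp]; linarith
        · have := add_lt_add_leftLim hf h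
          simp only at this
          linarith [htz.1]
      have h2 : t + z ≤ q := by
        have h3 : f t ≤ f ⟨b, right_mem_Icc.2 hab.le⟩ := hf t.2.2
        have := t.2.2
        simp only [hq]
        linarith [htz.2]
      have hqp : 0 < q - p := sub_pos.2 hpq
      -- The parameter solves $S(\sigma)=t+z$; a graph point is determined by the sum of its
      -- coordinates.
      refine ⟨⟨(t + z - p) / (q - p), div_nonneg (by linarith) hqp.le,
        (div_le_one hqp).2 (by linarith)⟩, ?_⟩
      set σ : unitInterval := ⟨(t + z - p) / (q - p), div_nonneg (by linarith) hqp.le,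
        (div_le_one hqp).2 (by linarith)⟩ with hσ
      have hSσ : S σ = t + z := by
        simp only [hS, hσ]
        field_simp
        ring
      have hrt : r σ = t := by
        have h3 : (r σ : ℝ) + Function.leftLim f (r σ) ≤ t + z := hSσ ▸ hr1 σ
        have h4 : (t : ℝ) + z ≤ r σ + f (r σ) := hSσ ▸ hr2 σ
        rcases lt_trichotomy (r σ) t with h | h | h
        · have := add_lt_add_leftLim hf h
          linarith [htz.1]
        · exact h
        · have := add_lt_add_leftLim hf h
          linarith [htz.2]
      simp [hSσ, hrt]
  · intro σ σ' h
    rcases (hrm h).eq_or_lt with h' | h'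
    · refine Or.inr ⟨h', ?_⟩
      have h1 := hr1 σ
      have h2 := hzm h
      simp only [hS] at h2 ⊢
      rw [abs_of_nonneg (by linarith), abs_of_nonneg (by linarith)]
      linarith
    · exact Or.inl h'

/-- Monotone functions which are close on a fine grid are `M₁`-close. -/
lemma mem_m1Ball_of_forall_grid (hab : a < b) {f g : Cadlag (Icc a b) ℝ} (hf : Monotone f)
    (hg : Monotone g) {F : Set (Icc a b)} {δ ε : ℝ} (hδ : 4 * δ < ε)
    (ha : ⟨a, left_mem_Icc.2 hab.le⟩ ∈ F) (hb : ⟨b, right_mem_Icc.2 hab.le⟩ ∈ F)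
    (hl : ∀ t : Icc a b, a < t → ∃ p ∈ F, p < t ∧ (t : ℝ) - p ≤ δ)
    (hr : ∀ t : Icc a b, ∃ p ∈ F, t ≤ p ∧ (p : ℝ) - t ≤ δ)
    (hF : ∀ p ∈ F, |g p - f p| ≤ δ) : g ∈ m1Ball f ε := by
  obtain ⟨r, z, hrz, hs⟩ := exists_isParamRep hab f hf
  obtain ⟨r', z', hrz', hs'⟩ := exists_isParamRep hab g hg
  -- At equal parameters the coordinate sums differ by at most `δ`, being convex combinations of the
  -- end values. The first coordinates differ by at most `3 * δ`, so the second ones by at most `4 *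
  -- δ`.
  refine ⟨r, z, r', z', hrz, hrz', 4 * δ, hδ, fun σ => ?_⟩
  have hδ0 : 0 ≤ δ := (abs_nonneg _).trans (hF _ ha)
  have hm : (r σ, z σ) ∈ completedGraph f := hrz.range_eq ▸ mem_range_self σ
  have hm' : (r' σ, z' σ) ∈ completedGraph g := hrz'.range_eq ▸ mem_range_self σ
  rw [mem_completedGraph_iff hf] at hm
  rw [mem_completedGraph_iff hg] at hm'
  simp only at hm hm'
  have hss : |((r σ : ℝ) + z σ) - (r' σ + z' σ)| ≤ δ := by
    rw [hs, hs']
    have h1 := abs_le.1 (hF _ ha)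
    have h2 := abs_le.1 (hF _ hb)
    have h3 := σ.2.1
    have h4 : 0 ≤ 1 - (σ : ℝ) := sub_nonneg.2 σ.2.2
    rw [abs_le]
    constructor <;> nlinarith
  have hrr : |(r σ : ℝ) - r' σ| ≤ 3 * δ := by
    rw [abs_le] at hss ⊢
    constructor
    · obtain ⟨q, hqF, hq, hqδ⟩ := hr (r σ)
      by_cases h : r' σ ≤ q
      · have : (r' σ : ℝ) ≤ q := h
        linarith
      · have h1 := hg.le_leftLim (not_le.1 h)
        have h2 := hf hq
        have h3 := abs_le.1 (hF q hqF)
        have h4 : (r σ : ℝ) ≤ q := hq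
        linarith
    · rcases eq_or_lt_of_le (r σ).2.1 with h | h
      · have := (r' σ).2.1
        linarith
      -- The grid point must lie strictly to the left: only then is $f(q)$ below the left limit of
      -- `f` at `r σ`, hence below `z σ`.
      · obtain ⟨q, hqF, hq, hqδ⟩ := hl (r σ) h
        by_cases h : q ≤ r' σ
        · have : (q : ℝ) ≤ r' σ := h
          linarith
        · have h1 := hf.le_leftLim hq
          have h2 := hg (not_le.1 h).le
          have h3 := abs_le.1 (hF q hqF)
          have h4 : (q : ℝ) < r σ := hq
          linarith
  rw [abs_le] at hss hrr ⊢
  rw [abs_le]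
  constructor <;> constructor <;> linarith

/-- A dense subset of `[a, b]` contains finite grids of arbitrarily small mesh. -/
lemma exists_finite_grid {D : Set (Icc a b)} (hD : Dense D) {δ : ℝ} (hδ : 0 < δ) (hab : a < b)
    (ha : ⟨a, left_mem_Icc.2 hab.le⟩ ∈ D) (hb : ⟨b, right_mem_Icc.2 hab.le⟩ ∈ D) :
    ∃ F ⊆ D, F.Finite ∧ ⟨a, left_mem_Icc.2 hab.le⟩ ∈ F ∧ ⟨b, right_mem_Icc.2 hab.le⟩ ∈ F ∧
      (∀ t : Icc a b, a < t → ∃ p ∈ F, p < t ∧ (t : ℝ) - p ≤ δ) ∧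
      ∀ t : Icc a b, ∃ p ∈ F, t ≤ p ∧ (p : ℝ) - t ≤ δ := by
  have hp : ∀ s : Icc a b, ∃ p ∈ D, (s : ℝ) - p ≤ δ / 2 ∧ ∀ᶠ t : Icc a b in 𝓝 s, a < (t : ℝ) → p < t := by
    intro s
    rcases eq_or_lt_of_le s.2.1 with h | h
    · exact ⟨_, ha, by simp only [← h]; linarith, Eventually.of_forall fun t ht => ht⟩
    · have hlt : (⟨max a (s - δ / 2), le_max_left _ _, max_le hab.le
        (by linarith [s.2.2])⟩ : Icc a b) < s := max_lt h (by linarith)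
      obtain ⟨p, hpD, hp⟩ := hD.exists_between hlt
      refine ⟨p, hpD, ?_, (eventually_gt_nhds hp.2).mono fun t ht _ => ht⟩
      have : max a (s - δ / 2) < p := hp.1
      linarith [le_max_right a (s - δ / 2)]
  have hq : ∀ s : Icc a b, ∃ p ∈ D, (p : ℝ) - s ≤ δ / 2 ∧ ∀ᶠ t in 𝓝 s, t ≤ p := by
    intro s
    rcases eq_or_lt_of_le s.2.2 with h | h
    · exact ⟨_, hb, by simp only [h]; linarith, Eventually.of_forall fun t => t.2.2⟩
    · have hlt : s < (⟨min b (s + δ / 2), le_min hab.le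
        (by linarith [s.2.1]), min_le_left _ _⟩ : Icc a b) := lt_min h (by linarith)
      obtain ⟨p, hpD, hp⟩ := hD.exists_between hlt
      refine ⟨p, hpD, ?_, (eventually_lt_nhds hp.1).mono fun t ht => ht.le⟩
      have : p < min b (s + δ / 2) := hp.2
      linarith [min_le_right b (s + δ / 2)]
  choose p hpD hps hpn using hp
  choose q hqD hqs hqn using hq
  -- Near `s` the points `p s` and `q s` bracket `t` and are at most `δ` apart, so a finite subcover
  -- yields the grid.
  have hU : ∀ s : Icc a b, {t : Icc a b | (a < (t : ℝ) → p s < t) ∧ t ≤ q s} ∈ 𝓝 s :=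
    fun s => (hpn s).and (hqn s)
  obtain ⟨T, hT⟩ := CompactSpace.elim_nhds_subcover _ hU
  refine ⟨insert ⟨a, left_mem_Icc.2 hab.le⟩ (insert ⟨b, right_mem_Icc.2 hab.le⟩
    (p '' T ∪ q '' T)), ?_, ?_, mem_insert _ _, mem_insert_of_mem _ (mem_insert _ _), ?_, ?_⟩
  · refine insert_subset ha (insert_subset hb (union_subset ?_ ?_))
    · rintro _ ⟨s, -, rfl⟩; exact hpD s
    · rintro _ ⟨s, -, rfl⟩; exact hqD s
  · exact (((T.finite_toSet.image p).union (T.finite_toSet.image q)).insert _).insert _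
  · intro t ht
    have : t ∈ ⋃ x ∈ T, {t : Icc a b | (a < (t : ℝ) → p x < t) ∧ t ≤ q x} := hT ▸ mem_univ t
    simp only [mem_iUnion, mem_ofPred_eq] at this
    obtain ⟨s, hsT, h1, h2⟩ := this
    refine ⟨p s, mem_insert_of_mem _ (mem_insert_of_mem _ (Or.inl ⟨s, hsT, rfl⟩)), h1 ht, ?_⟩
    have h3 : (t : ℝ) ≤ q s := h2
    linarith [hps s, hqs s]
  · intro t
    have : t ∈ ⋃ x ∈ T, {t : Icc a b | (a < (t : ℝ) → p x < t) ∧ t ≤ q x} := hT ▸ mem_univ t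
    simp only [mem_iUnion, mem_ofPred_eq] at this
    obtain ⟨s, hsT, h1, h2⟩ := this
    -- At `t = a` the lower bracket may fail, but `a` is itself a grid point.
    rcases eq_or_lt_of_le t.2.1 with h | h
    · exact ⟨_, mem_insert _ _, h.ge, by simp only [← h]; linarith⟩
    · refine ⟨q s, mem_insert_of_mem _ (mem_insert_of_mem _ (Or.inr ⟨s, hsT, rfl⟩)), h2, ?_⟩
      have h3 : (p s : ℝ) < t := h1 h
      linarith [hps s, hqs s]

/-- For monotone functions, closeness in the topology of pointwise convergence on a dense set that
contains the end points implies `M₁`-closeness. -/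
lemma exists_isOpen_forall_mem_m1Ball (hab : a < b) {D : Set (Icc a b)} (hD : Dense D)
    (ha : ⟨a, left_mem_Icc.2 hab.le⟩ ∈ D) (hb : ⟨b, right_mem_Icc.2 hab.le⟩ ∈ D)
    {f : Cadlag (Icc a b) ℝ} (hf : Monotone f) {ε : ℝ} (hε : 0 < ε) :
    ∃ W : Set (D → ℝ), IsOpen W ∧ (fun t : D => f t) ∈ W ∧
      ∀ g : Cadlag (Icc a b) ℝ, Monotone g → (fun t : D => g t) ∈ W → g ∈ m1Ball f ε := by
  obtain ⟨F, hFD, hFf, haF, hbF, hl, hr⟩ :=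
    exists_finite_grid hD (δ := ε / 5) (by linarith) hab ha hb
  have hfin : {t : D | (t : Icc a b) ∈ F}.Finite := hFf.preimage Subtype.val_injective.injOn
  refine ⟨⋂ t ∈ {t : D | (t : Icc a b) ∈ F}, {φ : D → ℝ | |φ t - f t| < ε / 5}, ?_, ?_, ?_⟩
  · exact hfin.isOpen_biInter fun t _ => isOpen_lt (by fun_prop) continuous_const
  · simp only [mem_iInter, mem_ofPred_eq, sub_self, abs_zero]
    intro _ _
    linarith
  · intro g hg hgW
    simp only [mem_iInter, mem_ofPred_eq] at hgW
    exact mem_m1Ball_of_forall_grid hab hf hg (δ := ε / 5) (by linarith) haF hbF hl hr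
      fun p hp => (hgW ⟨p, hFD hp⟩ hp).le

end Monotone

/-! ## The local `J₁` topology is pseudometrizable -/

section J1

lemma j1Nhd_mono {ι E : Type*} [LinearOrder ι] [PseudoMetricSpace ι] [PseudoMetricSpace E]
    (x : Cadlag ι E) {K L : Set ι} {ε δ : ℝ} (hK : K ⊆ L) (hε : δ ≤ ε) :
    j1Nhd x L δ ⊆ j1Nhd x K ε := by
  rintro y ⟨l, hl⟩
  exact ⟨l, fun t ht => ⟨(hl t (hK ht)).1.trans_le hε, (hl t (hK ht)).2.trans_le hε⟩⟩

variable {E : Type*} [PseudoMetricSpace E]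

/-- If an increasing bijection is `ε`-close to the identity up to time `T`, then it maps no time
after `T` to a time before `T - ε`. -/
lemma symm_le_of_forall_dist_lt {l : ℝ≥0 ≃o ℝ≥0} {T s : ℝ≥0} {ε : ℝ}
    (hl : dist (l T) T < ε) (hs : (s : ℝ) + ε ≤ T) : l.symm s ≤ T := by
  rw [OrderIso.symm_apply_le]
  have := (abs_lt.1 (NNReal.dist_eq _ _ ▸ hl)).1
  have h : (s : ℝ) ≤ l T := by linarith
  exact_mod_cast h

/-- The standard entourages of the local `J₁` uniformity. -/
def j1Entourage (E : Type*) [PseudoMetricSpace E] (n : ℕ) : Set (Cadlag ℝ≥0 E × Cadlag ℝ≥0 E) :=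
  {p | p.2 ∈ j1Nhd p.1 (Iic (n : ℝ≥0)) (1 / ((n : ℝ) + 1))}

lemma j1Entourage_antitone : Antitone (j1Entourage E) := fun m n h p hp =>
  j1Nhd_mono p.1 (Iic_subset_Iic.2 (by exact_mod_cast h))
    (one_div_le_one_div_of_le (by positivity) (by gcongr)) hp

lemma refl_mem_j1Entourage (n : ℕ) (x : Cadlag ℝ≥0 E) : (x, x) ∈ j1Entourage E n :=
  ⟨OrderIso.refl _, fun t _ => by simp; positivity⟩

/-- The inverse time change is controlled only where its values are at most `n + 1`. As
displacements stay below `1`, this covers all times up to `n`. -/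
lemma j1Entourage_symm {n : ℕ} {x y : Cadlag ℝ≥0 E} (h : (x, y) ∈ j1Entourage E (n + 1)) :
    (y, x) ∈ j1Entourage E n := by
  obtain ⟨l, hl⟩ := h
  have hn : 1 / (((n + 1 : ℕ) : ℝ) + 1) ≤ 1 / ((n : ℝ) + 1) :=
    one_div_le_one_div_of_le (by positivity) (by push_cast; linarith)
  have hn1 : 1 / (((n + 1 : ℕ) : ℝ) + 1) ≤ 1 := (div_le_one (by positivity)).2 (by
    push_cast; linarith [n.cast_nonneg (α := ℝ)])
  refine ⟨l.symm, fun s hs => ?_⟩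
  have hs' : l.symm s ≤ ((n + 1 : ℕ) : ℝ≥0) := by
    refine symm_le_of_forall_dist_lt (hl _ self_mem_Iic).1 ?_
    have : (s : ℝ) ≤ n := by exact_mod_cast (show s ≤ (n : ℝ≥0) from hs)
    push_cast at hn1 ⊢
    linarith
  have := hl _ hs'
  rw [OrderIso.apply_symm_apply] at this
  exact ⟨dist_comm s (l.symm s) ▸ this.1.trans_le hn,
    dist_comm (y s) (x (l.symm s)) ▸ this.2.trans_le hn⟩

/-- Index `2 * n + 1` makes the radius exactly half of the target radius, and leaves room for the
first time change to push times beyond `n`. -/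
lemma j1Entourage_comp {n : ℕ} {x y w : Cadlag ℝ≥0 E} (h : (x, y) ∈ j1Entourage E (2 * n + 1))
    (h' : (y, w) ∈ j1Entourage E (2 * n + 1)) : (x, w) ∈ j1Entourage E n := by
  obtain ⟨l, hl⟩ := h
  obtain ⟨k, hk⟩ := h'
  have hn : 1 / (((2 * n + 1 : ℕ) : ℝ) + 1) = 1 / ((n : ℝ) + 1) / 2 := by
    push_cast; field_simp; ring
  have hn1 : 1 / ((n : ℝ) + 1) / 2 ≤ 1 := by
    have : 1 / ((n : ℝ) + 1) ≤ 1 := (div_le_one (by positivity)).2 (by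
      linarith [n.cast_nonneg (α := ℝ)])
    linarith
  refine ⟨l.trans k, fun t ht => ?_⟩
  have ht0 : (t : ℝ) ≤ n := by exact_mod_cast (show t ≤ (n : ℝ≥0) from ht)
  have ht1 : t ≤ ((2 * n + 1 : ℕ) : ℝ≥0) := by
    have : (t : ℝ) ≤ ((2 * n + 1 : ℕ) : ℝ) := by push_cast; linarith [n.cast_nonneg (α := ℝ)]
    exact_mod_cast this
  have h1 := hl t ht1
  rw [hn] at h1
  have ht2 : l t ≤ ((2 * n + 1 : ℕ) : ℝ≥0) := by
    have h2 := (abs_lt.1 (NNReal.dist_eq _ _ ▸ h1.1)).2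
    have : (l t : ℝ) ≤ ((2 * n + 1 : ℕ) : ℝ) := by push_cast; linarith [n.cast_nonneg (α := ℝ)]
    exact_mod_cast this
  have h2 := hk _ ht2
  rw [hn] at h2
  have h3 := dist_triangle (k (l t)) (l t) t
  have h4 := dist_triangle (w (k (l t))) (y (l t)) (x t)
  simp only [OrderIso.trans_apply]
  constructor <;> linarith [h1.1, h1.2, h2.1, h2.2]

/-- The uniformity of the local `J₁` topology. -/
@[reducible] def j1UniformCore (E : Type*) [PseudoMetricSpace E] :
    UniformSpace.Core (Cadlag ℝ≥0 E) where
  uniformity := ⨅ n, 𝓟 (j1Entourage E n)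
  refl := by
    refine le_iInf fun n => principal_mono.2 ?_
    rintro ⟨x, y⟩ h
    obtain rfl : x = y := h
    exact refl_mem_j1Entourage n x
  symm := by
    refine tendsto_iInf.2 fun n => tendsto_iInf' (n + 1) (tendsto_principal_principal.2 ?_)
    rintro ⟨x, y⟩ h
    exact j1Entourage_symm h
  comp := by
    refine le_iInf fun n => le_principal_iff.2 ?_
    refine mem_of_superset (mem_lift' (mem_iInf_of_mem (2 * n + 1) (mem_principal_self _))) ?_
    rintro ⟨x, w⟩ ⟨y, h, h'⟩
    exact j1Entourage_comp h h'

lemma hasBasis_j1Uniformity :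
    (⨅ n, 𝓟 (j1Entourage E n)).HasBasis (fun _ => True) (j1Entourage E) :=
  hasBasis_iInf_principal (directed_of_isDirected_le fun _ _ h => j1Entourage_antitone h)

/-- Compact sets of times are bounded, so the intervals $[0,n]$ with radii $1/(n+1)$ are cofinal
among the data defining openness. -/
lemma j1Topology_eq : j1Topology ℝ≥0 E = (j1UniformCore E).toTopologicalSpace := by
  refine TopologicalSpace.ext_iff.2 fun U => ?_
  rw [@isOpen_uniformity _ (UniformSpace.ofCore (j1UniformCore E)) U]
  refine forall₂_congr fun x _ => ?_
  change _ ↔ _ ∈ (⨅ n, 𝓟 (j1Entourage E n))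
  rw [hasBasis_j1Uniformity.mem_iff]
  constructor
  · rintro ⟨K, hK, ε, hε, h⟩
    obtain ⟨B, hB⟩ := hK.bddAbove
    obtain ⟨n, hn⟩ := exists_nat_ge (max (B : ℝ) (1 / ε))
    refine ⟨n, trivial, ?_⟩
    rintro ⟨x', y⟩ hy rfl
    refine h (j1Nhd_mono _ ?_ ?_ hy)
    · intro t ht
      have : (t : ℝ) ≤ n := le_trans (by exact_mod_cast hB ht) ((le_max_left _ _).trans hn)
      exact_mod_cast this
    · rw [one_div_le (by positivity) hε]
      linarith [le_max_right (B : ℝ) (1 / ε)]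
  · rintro ⟨n, -, h⟩
    refine ⟨Iic n, by rw [← Icc_bot]; exact isCompact_Icc, 1 / ((n : ℝ) + 1), Nat.one_div_pos_of_nat, ?_⟩
    intro y hy
    exact h (show (x, y) ∈ j1Entourage E n from hy) rfl

attribute [local instance] j1Topology

instance pseudoMetrizableSpace_j1 : TopologicalSpace.PseudoMetrizableSpace (Cadlag ℝ≥0 E) := by
  let u : UniformSpace (Cadlag ℝ≥0 E) :=
    UniformSpace.ofCoreEq (j1UniformCore E) (j1Topology ℝ≥0 E) j1Topology_eq
  have : IsCountablyGenerated (uniformity (Cadlag ℝ≥0 E)) :=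
    hasBasis_j1Uniformity.isCountablyGenerated
  exact UniformSpace.pseudoMetrizableSpace

/-- Not immediate from the definition of the topology, since a basic neighbourhood need not be open;
the uniform structure supplies an open set inside it. -/
lemma j1Nhd_mem_nhds (x : Cadlag ℝ≥0 E) {K : Set ℝ≥0} (hK : BddAbove K) {ε : ℝ} (hε : 0 < ε) :
    j1Nhd x K ε ∈ 𝓝 x := by
  let u : UniformSpace (Cadlag ℝ≥0 E) :=
    UniformSpace.ofCoreEq (j1UniformCore E) (j1Topology ℝ≥0 E) j1Topology_eq
  obtain ⟨B, hB⟩ := hK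
  obtain ⟨n, hn⟩ := exists_nat_ge (max (B : ℝ) (1 / ε))
  have h : j1Entourage E n ∈ uniformity (Cadlag ℝ≥0 E) := hasBasis_j1Uniformity.mem_of_mem trivial
  refine mem_of_superset (UniformSpace.ball_mem_nhds x h) (j1Nhd_mono x ?_ ?_)
  · intro t ht
    have : (t : ℝ) ≤ n := le_trans (by exact_mod_cast hB ht) ((le_max_left _ _).trans hn)
    exact_mod_cast this
  · rw [one_div_le (by positivity) hε]
    linarith [le_max_right (B : ℝ) (1 / ε)]

end J1

/-! ## Semicontinuity of the scalar path in path and barrier -/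

section Scalar

attribute [local instance] j1Topology

variable {d : ℕ}

/-- The time change moves the crossing time `s` to `l s`, still in `I`, with nearby path value;
evaluation of a barrier is jointly continuous because $[0,\infty)\times\mathbb R^d$ is locally
compact. -/
lemma isOpen_exists_lt_scalarPath {I : Set ℝ≥0} (hI : IsOpen I) (v : ℝ) :
    IsOpen {e : Path d × Barrier d | ∃ s ∈ I, v < scalarPath e.1 e.2 s} := by
  rw [isOpen_iff_mem_nhds]
  rintro ⟨x, Φ⟩ ⟨s, hsI, hs⟩
  have hc : Continuous fun p : Barrier d × (ℝ≥0 × EuclideanSpace ℝ (Fin d)) => p.1 p.2 := by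
    fun_prop
  have h : ∀ᶠ p in 𝓝 (Φ, (s, x s)), v < p.1 p.2 := hc.continuousAt.eventually_const_lt hs
  rw [nhds_prod_eq, eventually_prod_iff] at h
  obtain ⟨pa, ha, pb, hb, hab⟩ := h
  obtain ⟨ε, hε, hεb⟩ := Metric.eventually_nhds_iff.1 hb
  obtain ⟨δ, hδ, hδI⟩ := Metric.isOpen_iff.1 hI s hsI
  have h1 := prod_mem_nhds (j1Nhd_mem_nhds x (bddAbove_singleton (a := s)) (lt_min hε hδ)) ha
  refine mem_of_superset h1 ?_
  rintro ⟨x', Φ'⟩ ⟨⟨l, hl⟩, hΦ'⟩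
  obtain ⟨h2, h3⟩ := hl s rfl
  refine ⟨l s, hδI (h2.trans_le (min_le_right _ _)), hab hΦ' (hεb ?_)⟩
  rw [Prod.dist_eq]
  exact max_lt (h2.trans_le (min_le_left _ _)) (h3.trans_le (min_le_left _ _))

/-- A càdlàg path is bounded on compact sets. -/
lemma isBounded_image_of_isCadlag {ι E : Type*} [LinearOrder ι] [TopologicalSpace ι]
    [PseudoMetricSpace E] {x : ι → E} (hx : IsCadlag x) {K : Set ι} (hK : IsCompact K) :
    Bornology.IsBounded (x '' K) := by
  refine hK.induction_on (p := fun s => Bornology.IsBounded (x '' s)) (by simp)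
    (fun s t hst ht => ht.subset (image_mono hst))
    (fun s t hs ht => by rw [image_union]; exact hs.union ht) fun t _ => ?_
  have key : ∀ (F : Filter ι) (l : E), Tendsto x F (𝓝 l) →
      ∃ U ∈ F, Bornology.IsBounded (x '' U) := fun F l h =>
    ⟨_, h (Metric.ball_mem_nhds l one_pos), Metric.isBounded_ball.subset (image_preimage_subset _ _)⟩
  obtain ⟨hr, l, hl⟩ := hx t
  obtain ⟨U, hU, hUb⟩ := key _ _ hr
  obtain ⟨V, hV, hVb⟩ := key _ _ hl
  refine ⟨V ∪ {t} ∪ U, mem_nhdsWithin_of_mem_nhds ?_, ?_⟩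
  · rw [← nhdsNE_sup_pure, ← nhdsLT_sup_nhdsGT]
    exact ⟨⟨mem_of_superset hV fun _ h => Or.inl (Or.inl h), mem_of_superset hU fun _ h => Or.inr h⟩,
      Or.inl (Or.inr rfl)⟩
  · rw [image_union, image_union, image_singleton]
    exact (hVb.union Bornology.isBounded_singleton).union hUb

/-- The graph of the path up to `c'` has compact closure, on which $\Phi\le v'$. Nearby barriers
stay below `v` on a compact neighbourhood of it, and nearby paths remain in that neighbourhood; the
gap `c' - c` absorbs the time change. -/
lemma eventually_forall_scalarPath_lt {e : Path d × Barrier d} {c c' : ℝ≥0} {v v' : ℝ}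
    (hc : c < c') (hv : v' < v) (h : ∀ s ≤ c', scalarPath e.1 e.2 s ≤ v') :
    ∀ᶠ e' in 𝓝 e, ∀ s ≤ c, scalarPath e'.1 e'.2 s < v := by
  obtain ⟨x, Φ⟩ := e
  set G : Set (ℝ≥0 × EuclideanSpace ℝ (Fin d)) := (fun t => (t, x t)) '' Iic c' with hG
  have hIic : IsCompact (Iic c') := by rw [← Icc_bot]; exact isCompact_Icc
  have hGb : Bornology.IsBounded G := by
    refine (hIic.isBounded.prod (isBounded_image_of_isCadlag x.isCadlag hIic)).subset ?_
    rintro _ ⟨t, ht, rfl⟩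
    exact ⟨ht, t, ht, rfl⟩
  have hGc : IsCompact (closure G) := hGb.isCompact_closure
  have hGv : closure G ⊆ {p | Φ p < v} := by
    have : closure G ⊆ {p | Φ p ≤ v'} := by
      refine closure_minimal ?_ (isClosed_le Φ.continuous continuous_const)
      rintro _ ⟨t, ht, rfl⟩
      exact h t ht
    exact this.trans fun p hp => lt_of_le_of_lt hp hv
  obtain ⟨L, hL, hGL, hLv⟩ :=
    exists_compact_between hGc (isOpen_lt Φ.continuous continuous_const) hGv
  obtain ⟨δ, hδ, hδL⟩ := hGc.exists_thickening_subset_open isOpen_interior hGL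
  have hcc : 0 < (c' : ℝ) - c := sub_pos.2 hc
  have h1 := prod_mem_nhds
    (j1Nhd_mem_nhds x (bddAbove_Iic (a := c')) (lt_min hδ hcc))
    ((ContinuousMap.isOpen_setOfPred_mapsTo hL isOpen_Iio).mem_nhds (x := Φ) hLv)
  refine mem_of_superset h1 ?_
  rintro ⟨x', Φ'⟩ ⟨⟨l, hl⟩, hΦ'⟩ s hs
  have hls : l.symm s ≤ c' := by
    refine symm_le_of_forall_dist_lt (hl c' self_mem_Iic).1 ?_
    have : (s : ℝ) ≤ c := hs
    linarith [min_le_right δ ((c' : ℝ) - c)]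
  obtain ⟨h2, h3⟩ := hl _ hls
  rw [OrderIso.apply_symm_apply] at h2 h3
  refine hΦ' (interior_subset (hδL ?_))
  refine Metric.mem_thickening_iff.2 ⟨(l.symm s, x (l.symm s)), subset_closure ⟨_, hls, rfl⟩, ?_⟩
  rw [Prod.dist_eq]
  exact max_lt (h2.trans_le (min_le_left _ _)) (h3.trans_le (min_le_left _ _))

end Scalar

/-! ## Convergence in distribution and almost surely continuous maps -/

section Mapping

lemma TendstoInDistribution.limsup_measure_le {ι E Ω' : Type*} {Ω : ι → Type*}
    {m : ∀ i, MeasurableSpace (Ω i)} {μ : (i : ι) → Measure (Ω i)} [∀ i, IsProbabilityMeasure (μ i)]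
    {m' : MeasurableSpace Ω'} {μ' : Measure Ω'} [IsProbabilityMeasure μ']
    [TopologicalSpace E] [TopologicalSpace.PseudoMetrizableSpace E]
    [MeasurableSpace E] [OpensMeasurableSpace E]
    {X : (i : ι) → Ω i → E} {Z : Ω' → E} {l : Filter ι}
    (h : TendstoInDistribution X l Z μ μ') {C : Set E} (hC : IsClosed C) :
    limsup (fun i => μ i (X i ⁻¹' C)) l ≤ μ' (Z ⁻¹' C) := by
  let _ := TopologicalSpace.pseudoMetrizableSpacePseudoMetric E
  have := ProbabilityMeasure.limsup_measure_closed_le_of_tendsto h.tendsto hC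
  simp only [ProbabilityMeasure.coe_mk] at this
  rw [Measure.map_apply_of_aemeasurable h.aemeasurable_limit hC.measurableSet] at this
  convert this using 3 with i
  rw [Measure.map_apply_of_aemeasurable (h.forall_aemeasurable i) hC.measurableSet]

/-- The mapping theorem: convergence in distribution is preserved by a universally measurable map
which is continuous at almost every value of the limit. -/
theorem TendstoInDistribution.comp_of_ae_continuousAt {ι E F Ω' : Type*} {Ω : ι → Type*}
    {m : ∀ i, MeasurableSpace (Ω i)} {μ : (i : ι) → Measure (Ω i)} [∀ i, IsProbabilityMeasure (μ i)]
    {m' : MeasurableSpace Ω'} {μ' : Measure Ω'} [IsProbabilityMeasure μ']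
    [TopologicalSpace E] [TopologicalSpace.PseudoMetrizableSpace E]
    [MeasurableSpace E] [OpensMeasurableSpace E]
    [TopologicalSpace F] [MeasurableSpace F] [OpensMeasurableSpace F]
    {X : (i : ι) → Ω i → E} {Z : Ω' → E} {l : Filter ι} [l.IsCountablyGenerated] {g : E → F}
    (h : TendstoInDistribution X l Z μ μ')
    (hg : ∀ (ν : Measure E) [IsFiniteMeasure ν], AEMeasurable g ν)
    (hc : ∀ᵐ ω ∂μ', ContinuousAt g (Z ω)) :
    TendstoInDistribution (fun i ω => g (X i ω)) l (fun ω => g (Z ω)) μ μ' where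
  forall_aemeasurable i := (hg _).comp_aemeasurable (h.forall_aemeasurable i)
  aemeasurable_limit := (hg _).comp_aemeasurable h.aemeasurable_limit
  tendsto := by
    refine tendsto_of_forall_isClosed_limsup_le' fun C hC => ?_
    simp only [ProbabilityMeasure.coe_mk]
    have hZ : AEMeasurable (fun ω => g (Z ω)) μ' := (hg _).comp_aemeasurable h.aemeasurable_limit
    have hX : ∀ i, AEMeasurable (fun ω => g (X i ω)) (μ i) :=
      fun i => (hg _).comp_aemeasurable (h.forall_aemeasurable i)
    rw [Measure.map_apply_of_aemeasurable hZ hC.measurableSet]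
    -- The preimage of `C` need not be closed. Passing to its closure costs nothing in the limit,
    -- since at a continuity point of `g` membership in the closure already forces the image into
    -- `C`.
    calc limsup (fun i => (μ i).map (fun ω => g (X i ω)) C) l
        ≤ limsup (fun i => μ i (X i ⁻¹' closure (g ⁻¹' C))) l := by
          refine limsup_le_limsup (Eventually.of_forall fun i => ?_)
          simp only
          rw [Measure.map_apply_of_aemeasurable (hX i) hC.measurableSet]
          exact measure_mono fun ω hω => subset_closure hω
      _ ≤ μ' (Z ⁻¹' closure (g ⁻¹' C)) :=
          TendstoInDistribution.limsup_measure_le h isClosed_closure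
      _ ≤ μ' ((fun ω => g (Z ω)) ⁻¹' C) := by
          refine measure_mono_ae ?_
          filter_upwards [hc] with ω hω hZ
          have := mem_closure_image hω hZ
          exact closure_minimal (image_preimage_subset g C) hC this

end Mapping

/-! ## Measurability of first-passage times -/

section Measurability

variable {α : Type*} [MeasurableSpace α] {ν : Measure α}

/-- The first-passage time of a right-continuous process is measurable for the completion of every
finite measure. (In general it is not Borel measurable.) -/
lemma aemeasurable_passageTime [IsFiniteMeasure ν] {y : α → ℝ≥0 → ℝ}
    (hy : ∀ ω t, ContinuousWithinAt (y ω) (Ioi t) t)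
    (hm : ∀ I : Set ℝ≥0, IsOpen I → ∀ v, MeasurableSet {ω | ∃ s ∈ I, v < y ω s}) (u : ℝ) :
    AEMeasurable (fun ω => passageTime (y ω) u) ν := by
  -- Truncation makes the integrals finite, so that equality of integrals can be turned into almost
  -- everywhere equality.
  suffices H : ∀ N : ℕ, AEMeasurable (fun ω => min (passageTime (y ω) u) N) ν by
    have : (fun ω => passageTime (y ω) u) = fun ω => ⨆ N : ℕ, min (passageTime (y ω) u) N := by
      ext ω
      rw [← inf_iSup_eq, ENNReal.iSup_natCast, inf_top_eq]
    rw [this]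
    exact AEMeasurable.iSup H
  intro N
  -- `g` is a measurable minorant with maximal integral. `R k` is the first time after `g` at which
  -- the path exceeds $u-1/(k+1)$; being a strict crossing, it is measurable.
  obtain ⟨g, hgm, hgle, hgint⟩ :=
    exists_measurable_le_lintegral_eq ν fun ω => min (passageTime (y ω) u) (N : ℝ≥0∞)
  set R : ℕ → α → ℝ≥0∞ := fun k ω =>
    ⨅ (s : ℝ≥0) (_ : g ω < s ∧ u - 1 / ((k : ℝ) + 1) < y ω s), (s : ℝ≥0∞) with hR
  have hRm : ∀ k, Measurable (R k) := by
    intro k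
    refine measurable_of_Iio fun c => ?_
    have : R k ⁻¹' Iio c = ⋃ q : ℚ, {ω | g ω < (Real.toNNReal q : ℝ≥0∞)} ∩
        {ω | ∃ s ∈ {s : ℝ≥0 | Real.toNNReal q < s ∧ (s : ℝ≥0∞) < c},
          u - 1 / ((k : ℝ) + 1) < y ω s} := by
      ext ω
      simp only [hR, mem_preimage, mem_Iio, iInf_lt_iff, mem_iUnion, mem_inter_iff, mem_ofPred_eq,
        exists_prop]
      constructor
      · rintro ⟨s, ⟨h1, h2⟩, h3⟩
        obtain ⟨q, -, hq1, hq2⟩ := ENNReal.lt_iff_exists_rat_btwn.1 h1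
        exact ⟨q, hq1, s, ⟨ENNReal.coe_lt_coe.1 hq2, h3⟩, h2⟩
      · rintro ⟨q, hq, s, ⟨h1, h3⟩, h2⟩
        exact ⟨s, ⟨hq.trans (ENNReal.coe_lt_coe.2 h1), h2⟩, h3⟩
    rw [this]
    refine MeasurableSet.iUnion fun q => (measurableSet_lt hgm measurable_const).inter (hm _ ?_ _)
    exact isOpen_Ioi.inter (isOpen_Iio.preimage ENNReal.continuous_coe)
  have hRle : ∀ k ω, R k ω ≤ passageTime (y ω) u := by
    intro k ω
    refine le_iInf₂ fun t ht => ?_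
    have h1 : ∀ᶠ s in 𝓝[>] t, u - 1 / ((k : ℝ) + 1) < y ω s :=
      (hy ω t).eventually_const_lt (lt_of_lt_of_le (sub_lt_self _ Nat.one_div_pos_of_nat) ht)
    have h2 : Tendsto (fun s : ℝ≥0 => (s : ℝ≥0∞)) (𝓝[>] t) (𝓝 t) :=
      (ENNReal.continuous_coe.tendsto t).mono_left nhdsWithin_le_nhds
    refine ge_of_tendsto h2 ?_
    filter_upwards [h1, self_mem_nhdsWithin] with s hs hts
    refine iInf₂_le s ⟨lt_of_le_of_lt ?_ (ENNReal.coe_lt_coe.2 hts), hs⟩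
    exact ((hgle ω).trans (min_le_left _ _)).trans (iInf₂_le t ht)
  have hgR : ∀ k ω, g ω ≤ R k ω := fun k ω => le_iInf₂ fun s hs => hs.1.le
  -- The right-hand side is a measurable function between `g` and the truncated passage time, so
  -- maximality of the integral leaves no gap.
  have hae : g =ᵐ[ν] fun ω => min (⨆ k, R k ω) N := by
    refine ae_eq_of_ae_le_of_lintegral_le (Eventually.of_forall fun ω => ?_) ?_
      ((Measurable.iSup hRm).min measurable_const).aemeasurable ?_
    · exact le_min ((hgR 0 ω).trans (le_iSup (fun k => R k ω) 0)) ((hgle ω).trans (min_le_right _ _))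
    · refine ne_of_lt (lt_of_le_of_lt
        (lintegral_mono fun ω => (hgle ω).trans (min_le_right _ _)) ?_)
      rw [lintegral_const]
      exact ENNReal.mul_lt_top (ENNReal.natCast_lt_top N) (measure_lt_top ν _)
    · rw [← hgint]
      exact lintegral_mono fun ω => min_le_min_right _ (iSup_le fun k => hRle k ω)
  refine ⟨g, hgm, ?_⟩
  filter_upwards [hae] with ω hω
  refine le_antisymm ?_ (hgle ω)
  -- If `g` stopped early at `t`, then $y(t)<u$, and right-continuity would keep the path below some
  -- $u-1/(k+1)$ just after `t`. This pushes `R k` strictly beyond `t`, against the almost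
  -- everywhere identity.
  by_contra! hlt
  obtain ⟨hlt1, hlt2⟩ := lt_min_iff.1 hlt
  lift g ω to ℝ≥0 using hlt2.ne_top with t ht
  have hsup : ∀ k, R k ω ≤ t := by
    intro k
    rcases min_choice (⨆ k, R k ω) (N : ℝ≥0∞) with h | h
    · rw [hω, h]
      exact le_iSup (fun k => R k ω) k
    · rw [hω, h] at hlt2
      exact absurd hlt2 (lt_irrefl _)
  have hyt : y ω t < u := by
    by_contra! h
    exact absurd (iInf₂_le t h) (not_le.2 hlt1)
  obtain ⟨k, hk⟩ := exists_nat_one_div_lt (sub_pos.2 hyt)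
  have h1 : ∀ᶠ s in 𝓝[>] t, y ω s < u - 1 / ((k : ℝ) + 1) :=
    (hy ω t).eventually_lt_const (by linarith)
  obtain ⟨w, hw, hws⟩ := (mem_nhdsGT_iff_exists_Ioo_subset).1 h1
  have h2 : (w : ℝ≥0∞) ≤ R k ω := by
    refine le_iInf₂ fun s hs => ?_
    by_contra! hsw
    have hts : t < s := by
      have := hs.1
      rw [← ht] at this
      exact ENNReal.coe_lt_coe.1 this
    have := hws ⟨hts, ENNReal.coe_lt_coe.1 hsw⟩
    exact absurd hs.2 (not_lt.2 (le_of_lt this))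
  exact absurd (ENNReal.coe_le_coe.1 (h2.trans (hsup k))) (not_le.2 hw)

variable {a b : ℝ}

lemma aemeasurable_rightLim {F : α → Icc a b → ℝ} (hF : ∀ ω, Monotone (F ω))
    (hm : ∀ u, AEMeasurable (fun ω => F ω u) ν) (u : Icc a b) :
    AEMeasurable (fun ω => Function.rightLim (F ω) u) ν := by
  rcases eq_or_neBot (𝓝[>] u) with h | h
  · simp only [rightLim_eq_of_eq_bot _ h]
    exact hm u
  · obtain ⟨x, hx⟩ := exists_seq_tendsto (𝓝[>] u)
    exact aemeasurable_of_tendsto_metrizable_ae atTop (fun n => hm (x n))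
      (Eventually.of_forall fun ω => ((hF ω).tendsto_rightLim u).comp hx)

lemma exitProfile_apply {z : Cadlag (Icc a b) ℝ} {y : ℝ≥0 → ℝ} (h : passageTime y b ≠ ∞) :
    (exitProfile z y).toFun = Function.rightLim fun u : Icc a b => (passageTime y u).toReal := by
  rw [exitProfile, dif_pos h]

lemma monotone_exitProfile {z : Cadlag (Icc a b) ℝ} {y : ℝ≥0 → ℝ} (h : passageTime y b ≠ ∞) :
    Monotone (exitProfile z y) := by
  rw [exitProfile_apply h]
  exact (monotone_toReal_passageTime h).rightLim

lemma exitProfile_of_eq_top {z : Cadlag (Icc a b) ℝ} {y : ℝ≥0 → ℝ} (h : passageTime y b = ∞) :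
    exitProfile z y = z := by
  rw [exitProfile, dif_neg (not_not.2 h)]

/-- The exit-time profile of a right-continuous process is measurable for the completion of every
finite measure and the Borel `σ`-algebra of the `M₁` topology. -/
lemma aemeasurable_exitProfile [IsFiniteMeasure ν] (hab : a < b) {y : α → ℝ≥0 → ℝ}
    (hy : ∀ ω t, ContinuousWithinAt (y ω) (Ioi t) t)
    (hm : ∀ I : Set ℝ≥0, IsOpen I → ∀ v, MeasurableSet {ω | ∃ s ∈ I, v < y ω s})
    (z : Cadlag (Icc a b) ℝ) :
    @AEMeasurable _ _ (@borel _ (m1Topology a b)) _ (fun ω => exitProfile z (y ω)) ν := by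
  classical
  let _ : TopologicalSpace (Cadlag (Icc a b) ℝ) := m1Topology a b
  let _ : MeasurableSpace (Cadlag (Icc a b) ℝ) := borel _
  have : BorelSpace (Cadlag (Icc a b) ℝ) := ⟨rfl⟩
  obtain ⟨D₀, hD₀c, hD₀⟩ := TopologicalSpace.exists_countable_dense (Icc a b)
  set D : Set (Icc a b) := insert ⟨a, left_mem_Icc.2 hab.le⟩
    (insert ⟨b, right_mem_Icc.2 hab.le⟩ D₀) with hDdef
  have hD : Dense D := hD₀.mono ((subset_insert _ _).trans (subset_insert _ _))
  have : Countable D := ((hD₀c.insert _).insert _).to_subtype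
  have hT := aemeasurable_passageTime (ν := ν) hy hm
  -- The indicator keeps `F ω` monotone when the top level is never reached, where `toReal` would
  -- send `∞` to `0`.
  set F : α → Icc a b → ℝ := fun ω u =>
    {ω | passageTime (y ω) b ≠ ∞}.indicator (fun ω => (passageTime (y ω) u).toReal) ω with hF
  have hFe : ∀ ω, passageTime (y ω) b ≠ ∞ →
      F ω = fun u : Icc a b => (passageTime (y ω) u).toReal := by
    intro ω hω
    ext u
    exact indicator_of_mem (s := {ω | passageTime (y ω) b ≠ ∞}) hω _
  have hFm : ∀ ω, Monotone (F ω) := by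
    intro ω
    by_cases hω : passageTime (y ω) b = ∞
    · have : F ω = fun _ => 0 := by
        ext u
        exact indicator_of_notMem (s := {ω | passageTime (y ω) b ≠ ∞}) (not_not.2 hω) _
      rw [this]
      exact monotone_const
    · rw [hFe ω hω]
      exact monotone_toReal_passageTime hω
  have hψ : AEMeasurable (fun ω => (passageTime (y ω) b,
      fun t : D => Function.rightLim (F ω) (t : Icc a b))) ν := by
    refine (hT b).prodMk (aemeasurable_pi_lambda _ fun t => aemeasurable_rightLim hFm (fun u => ?_) _)
    exact (hT u).ennreal_toReal.indicator₀
      ((hT b).nullMeasurableSet_preimage (measurableSet_singleton ∞).compl)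
  obtain ⟨φ, hφm, hφ⟩ := hψ
  set N := toMeasurable ν {ω | ¬ (passageTime (y ω) b,
      fun t : D => Function.rightLim (F ω) (t : Icc a b)) = φ ω} with hN
  have hNm : MeasurableSet N := measurableSet_toMeasurable _ _
  have hN0 : ν N = 0 := by rw [hN, measure_toMeasurable]; exact hφ
  have hNφ : ∀ ω ∉ N, (passageTime (y ω) b,
      fun t : D => Function.rightLim (F ω) (t : Icc a b)) = φ ω := by
    intro ω hω
    by_contra h
    exact hω (subset_toMeasurable _ _ h)
  refine ⟨fun ω => if ω ∈ N ∨ (φ ω).1 = ∞ then z else exitProfile z (y ω), ?_, ?_⟩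
  · refine measurable_of_isOpen fun U hU => ?_
    have hW : ∀ f : Cadlag (Icc a b) ℝ, ∃ W : Set (D → ℝ), IsOpen W ∧
        (f ∈ U → Monotone f → (fun t : D => f t) ∈ W) ∧
        ∀ g : Cadlag (Icc a b) ℝ, Monotone g → (fun t : D => g t) ∈ W → g ∈ U := by
      intro f
      by_cases hf : f ∈ U ∧ Monotone f
      · obtain ⟨ε, hε, hεU⟩ := hU f hf.1
        obtain ⟨W, hWo, hfW, hW⟩ := exists_isOpen_forall_mem_m1Ball hab hD (mem_insert _ _)
          (mem_insert_of_mem _ (mem_insert _ _)) hf.2 hε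
        exact ⟨W, hWo, fun _ _ => hfW, fun g hg hgW => hεU (hW g hg hgW)⟩
      · exact ⟨∅, isOpen_empty, fun h1 h2 => absurd ⟨h1, h2⟩ hf, fun g _ h => absurd h (notMem_empty _)⟩
    choose W hWo hfW hW using hW
    have hpre : (fun ω => if ω ∈ N ∨ (φ ω).1 = ∞ then z else exitProfile z (y ω)) ⁻¹' U =
        (({ω | ω ∈ N} ∪ {ω | (φ ω).1 = ∞}) ∩ {_ω | z ∈ U}) ∪
        (({ω | ω ∈ N} ∪ {ω | (φ ω).1 = ∞})ᶜ ∩ {ω | (φ ω).2 ∈ ⋃ f, W f}) := by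
      ext ω
      simp only [mem_preimage, mem_union, mem_inter_iff, mem_compl_iff, mem_ofPred_eq]
      by_cases hω : ω ∈ N ∨ (φ ω).1 = ∞
      · simp [hω]
      · simp only [hω, if_false, false_and, not_false_eq_true, true_and, false_or]
        have h1 := hNφ ω fun h => hω (Or.inl h)
        have h2 : passageTime (y ω) b ≠ ∞ := fun h => hω (Or.inr (by rw [← h1]; exact h))
        have h3 : (fun t : D => exitProfile z (y ω) (t : Icc a b)) = (φ ω).2 := by
          rw [← h1, exitProfile_apply h2, hFe ω h2]
        rw [← h3, mem_iUnion]
        exact ⟨fun h => ⟨_, hfW _ h (monotone_exitProfile h2)⟩,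
          fun ⟨f, hf⟩ => hW f _ (monotone_exitProfile h2) hf⟩
    rw [hpre]
    have hB : MeasurableSet ({ω | ω ∈ N} ∪ {ω | (φ ω).1 = ∞}) :=
      hNm.union (hφm.fst (measurableSet_singleton ∞))
    exact (hB.inter (MeasurableSet.const _)).union
      (hB.compl.inter (hφm.snd (isOpen_iUnion hWo).measurableSet))
  · filter_upwards [measure_eq_zero_iff_ae_notMem.1 hN0] with ω hω
    split_ifs with h
    · refine exitProfile_of_eq_top ?_
      have := h.resolve_left hω
      rw [← hNφ ω hω] at this
      exact this
    · rfl

end Measurability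

/-! ## Continuity of the exit-time profile -/

section Continuity

variable {a b : ℝ}

lemma passageTime_le_coe {y : ℝ≥0 → ℝ} {u : ℝ} {s : ℝ≥0} (h : u ≤ y s) : passageTime y u ≤ s :=
  iInf₂_le s h

lemma coe_le_passageTime {y : ℝ≥0 → ℝ} {u : ℝ} {c : ℝ≥0} (h : ∀ s < c, y s < u) :
    (c : ℝ≥0∞) ≤ passageTime y u := by
  refine le_iInf₂ fun t ht => ENNReal.coe_le_coe.2 ?_
  by_contra! htc
  exact absurd ht (not_le.2 (h t htc))

lemma passageTime_toReal_le {y : ℝ≥0 → ℝ} {u : ℝ} {s : ℝ≥0} (h : u ≤ y s) :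
    (passageTime y u).toReal ≤ s := by
  have := ENNReal.toReal_mono ENNReal.coe_ne_top (passageTime_le_coe h)
  rwa [ENNReal.coe_toReal] at this

lemma le_exitProfile {z : Cadlag (Icc a b) ℝ} {y : ℝ≥0 → ℝ} (h : passageTime y b ≠ ∞)
    (u : Icc a b) : (passageTime y u).toReal ≤ exitProfile z y u := by
  rw [exitProfile_apply h]
  exact (monotone_toReal_passageTime h).le_rightLim le_rfl

lemma exitProfile_right {z : Cadlag (Icc a b) ℝ} {y : ℝ≥0 → ℝ} (h : passageTime y b ≠ ∞)
    {u : Icc a b} (hu : (u : ℝ) = b) : exitProfile z y u = (passageTime y b).toReal := by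
  rw [exitProfile_apply h, rightLim_eq_of_isTop fun t : Icc a b => show t ≤ u from t.2.2.trans hu.ge, hu]

/-- Strict crossing is needed because the right-continuous modification looks at levels above `u`;
the level `min b (y s)` is such a level when `u < b`, and is reached by time `s`. -/
lemma exitProfile_le {z : Cadlag (Icc a b) ℝ} {y : ℝ≥0 → ℝ} (h : passageTime y b ≠ ∞)
    {u : Icc a b} {s : ℝ≥0} (hs : (u : ℝ) < y s) : exitProfile z y u ≤ s := by
  rcases eq_or_lt_of_le u.2.2 with hu | hu
  · rw [exitProfile_right h hu]
    exact passageTime_toReal_le (hu ▸ hs.le)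
  · rw [exitProfile_apply h]
    have hv : min b (y s) ∈ Icc a b := ⟨u.2.1.trans (le_min hu.le hs.le), min_le_left _ _⟩
    exact ((monotone_toReal_passageTime h).rightLim_le
      (show u < ⟨min b (y s), hv⟩ from lt_min hu hs)).trans
      (passageTime_toReal_le (min_le_right _ _))

lemma IsRegularLevel.exists_lt {y : ℝ≥0 → ℝ} {u : ℝ} (h : IsRegularLevel y u) {c : ℝ}
    (hc : (passageTime y u).toReal < c) : ∃ s : ℝ≥0, (s : ℝ) < c ∧ u < y s := by
  obtain ⟨hT, h⟩ := h
  lift passageTime y u to ℝ≥0 using hT.ne with t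
  rw [ENNReal.coe_toReal] at hc
  obtain ⟨s, -, hs, hus⟩ := h (Real.toNNReal ((c - t) / 2)) (Real.toNNReal_pos.2 (by linarith))
  refine ⟨s, ?_, hus⟩
  have h1 : s ≤ t + Real.toNNReal ((c - t) / 2) := by exact_mod_cast hs
  have h2 : (s : ℝ) ≤ t + Real.toNNReal ((c - t) / 2) := by exact_mod_cast h1
  rw [Real.coe_toNNReal _ (by linarith)] at h2
  linarith

/-- At a regular level the exit-time profile is the first-passage time. -/
lemma exitProfile_eq_of_isRegularLevel {z : Cadlag (Icc a b) ℝ} {y : ℝ≥0 → ℝ}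
    (h : passageTime y b ≠ ∞) {u : Icc a b} (hu : IsRegularLevel y u) :
    exitProfile z y u = (passageTime y u).toReal := by
  refine le_antisymm (le_of_forall_gt_imp_ge_of_dense fun c hc => ?_) (le_exitProfile h u)
  obtain ⟨s, hs, hus⟩ := hu.exists_lt hc
  exact (exitProfile_le h hus).trans hs.le

/-- Convergence of the exit-time profiles at a level `u`, from approximate crossing of `u` after the
limit profile and separation from `u` before it. -/
lemma tendsto_exitProfile_apply {J : Type*} {L : Filter J} {η : J → ℝ≥0 → ℝ} {y : ℝ≥0 → ℝ}
    (hU : ∀ I : Set ℝ≥0, IsOpen I → ∀ v, (∃ s ∈ I, v < y s) → ∀ᶠ i in L, ∃ s ∈ I, v < η i s)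
    (hL : ∀ (c c' : ℝ≥0) (v v' : ℝ), c < c' → v' < v → (∀ s ≤ c', y s ≤ v') →
      ∀ᶠ i in L, ∀ s ≤ c, η i s < v)
    (z : Cadlag (Icc a b) ℝ) (hfin : ∀ᶠ i in L, passageTime (η i) b ≠ ∞) {u : Icc a b}
    (hu : ∀ c : ℝ, exitProfile z y u < c → ∃ s : ℝ≥0, (s : ℝ) < c ∧ (u : ℝ) < y s)
    (hu' : ∀ c : ℝ≥0, (c : ℝ) < exitProfile z y u →
      ∃ v' < (u : ℝ), ∃ c' > c, ∀ s ≤ c', y s ≤ v') :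
    Tendsto (fun i => exitProfile z (η i) u) L (𝓝 (exitProfile z y u)) := by
  refine tendsto_order.2 ⟨fun r hr => ?_, fun c hc => ?_⟩
  · rcases lt_or_ge r 0 with h0 | h0
    · filter_upwards [hfin] with i hi
      exact h0.trans_le (ENNReal.toReal_nonneg.trans (le_exitProfile hi u))
    · obtain ⟨c, hrc, hcu⟩ := exists_between hr
      lift c to ℝ≥0 using h0.trans hrc.le
      obtain ⟨v', hv', c', hc', h⟩ := hu' c hcu
      filter_upwards [hfin, hL c c' u v' hc' hv' h] with i hi h
      refine hrc.trans_le (le_trans ?_ (le_exitProfile hi u))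
      have h1 : passageTime (η i) u ≠ ∞ := ne_top_of_le_ne_top hi (passageTime_mono _ u.2.2)
      have h2 := ENNReal.toReal_mono h1 (coe_le_passageTime fun s hs => h s (le_of_lt hs))
      rwa [ENNReal.coe_toReal] at h2
  · obtain ⟨s, hs⟩ := hu c hc
    filter_upwards [hfin, hU {s : ℝ≥0 | (s : ℝ) < c} (isOpen_lt (by fun_prop) continuous_const) u
      ⟨s, hs⟩] with i hi ⟨t, ht, hut⟩
    exact (exitProfile_le hi hut).trans_lt ht

/-- The exit-time profile on `[a, b]` is `M₁`-continuous at scalar paths for which `a` and `b` are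
regular levels with strict separation before first passage. -/
lemma eventually_exitProfile_mem_m1Ball (hab : a < b) {J : Type*} {L : Filter J}
    {η : J → ℝ≥0 → ℝ} {y : ℝ≥0 → ℝ}
    (hU : ∀ I : Set ℝ≥0, IsOpen I → ∀ v, (∃ s ∈ I, v < y s) → ∀ᶠ i in L, ∃ s ∈ I, v < η i s)
    (hL : ∀ (c c' : ℝ≥0) (v v' : ℝ), c < c' → v' < v → (∀ s ≤ c', y s ≤ v') →
      ∀ᶠ i in L, ∀ s ≤ c, η i s < v)
    (ha : IsRegularLevel y a) (hb : IsRegularLevel y b)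
    (hsa : IsSeparatedBefore y a) (hsb : IsSeparatedBefore y b)
    (z : Cadlag (Icc a b) ℝ) {ε : ℝ} (hε : 0 < ε) :
    ∀ᶠ i in L, exitProfile z (η i) ∈ m1Ball (exitProfile z y) ε := by
  have hfin : ∀ᶠ i in L, passageTime (η i) b ≠ ∞ := by
    obtain ⟨s, -, hs⟩ := hb.exists_lt (lt_add_one _)
    filter_upwards [hU univ isOpen_univ b ⟨s, trivial, hs⟩] with i ⟨t, _, ht⟩
    exact ne_top_of_le_ne_top ENNReal.coe_ne_top (passageTime_le_coe ht.le)
  have hT : passageTime y b ≠ ∞ := hb.1.ne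
  set F : Icc a b → ℝ := fun u => (passageTime y u).toReal with hF
  have hFm : Monotone F := monotone_toReal_passageTime hT
  have hTu : ∀ u : Icc a b, passageTime y u ≠ ∞ :=
    fun u => ne_top_of_le_ne_top hT (passageTime_mono _ u.2.2)
  set D : Set (Icc a b) :=
    {u | Tendsto (fun i => exitProfile z (η i) u) L (𝓝 (exitProfile z y u))} with hD
  have hreg : ∀ u : Icc a b, IsRegularLevel y u → IsSeparatedBefore y u → u ∈ D := by
    intro u hu hsu
    refine tendsto_exitProfile_apply hU hL z hfin ?_ ?_
    · rw [exitProfile_eq_of_isRegularLevel hT hu]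
      exact fun c hc => hu.exists_lt hc
    · rw [exitProfile_eq_of_isRegularLevel hT hu]
      intro c hc
      obtain ⟨c', hcc', hc'⟩ := exists_between hc
      lift c' to ℝ≥0 using c.2.trans hcc'.le
      have hc'' : (c' : ℝ≥0∞) < passageTime y u := by
        rwa [← ENNReal.toReal_lt_toReal ENNReal.coe_ne_top (hTu u), ENNReal.coe_toReal]
      obtain ⟨v', hv', h⟩ := hsu c' hc''
      exact ⟨v', hv', c', NNReal.coe_lt_coe.1 hcc', h⟩
  have haD : (⟨a, left_mem_Icc.2 hab.le⟩ : Icc a b) ∈ D := hreg _ ha hsa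
  have hbD : (⟨b, right_mem_Icc.2 hab.le⟩ : Icc a b) ∈ D := hreg _ hb hsb
  -- Continuity replaces regularity and separation: a level above `u` is passed soon after, which
  -- gives a crossing of `u`, and a level `w < u` is passed only shortly before, so the path stays
  -- below `w` until then.
  have hcD : ∀ u : Icc a b, a < u → (u : ℝ) < b → ContinuousAt F u → u ∈ D := by
    intro u hau hub hc
    have : (𝓝[<] u).NeBot :=
      nhdsLT_neBot_of_exists_lt ⟨⟨a, left_mem_Icc.2 hab.le⟩, hau⟩
    have : (𝓝[>] u).NeBot :=
      nhdsGT_neBot_of_exists_gt ⟨⟨b, right_mem_Icc.2 hab.le⟩, hub⟩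
    have hfu : exitProfile z y u = Function.rightLim F u := by rw [exitProfile_apply hT]
    refine tendsto_exitProfile_apply hU hL z hfin ?_ ?_
    · intro c hc
      rw [hfu] at hc
      obtain ⟨v, hv, huv⟩ :=
        (((hFm.tendsto_rightLim u).eventually_lt_const hc).and self_mem_nhdsWithin).exists
      have hc0 : 0 ≤ c := ENNReal.toReal_nonneg.trans hv.le
      lift c to ℝ≥0 using hc0
      have hv' : passageTime y v < c := by
        rwa [← ENNReal.toReal_lt_toReal (hTu v) ENNReal.coe_ne_top, ENNReal.coe_toReal]
      obtain ⟨t, ht⟩ := iInf_lt_iff.1 hv'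
      obtain ⟨hvt, htc⟩ := iInf_lt_iff.1 ht
      exact ⟨t, by exact_mod_cast htc, lt_of_lt_of_le huv hvt⟩
    · intro c hcu
      rw [hfu, ← hFm.continuousAt_iff_leftLim_eq_rightLim.1 hc] at hcu
      obtain ⟨w, hw, hwu⟩ :=
        (((hFm.tendsto_leftLim u).eventually_const_lt hcu).and self_mem_nhdsWithin).exists
      obtain ⟨c', hcc', hc'⟩ := exists_between hw
      lift c' to ℝ≥0 using c.2.trans hcc'.le
      refine ⟨w, hwu, c', NNReal.coe_lt_coe.1 hcc', fun s hs => ?_⟩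
      by_contra! hws
      have h1 := passageTime_toReal_le hws.le
      have h2 : (s : ℝ) ≤ c' := hs
      simp only [hF] at hc'
      linarith
  have hDd : Dense D := by
    have : Nontrivial (Icc a b) := ⟨⟨a, left_mem_Icc.2 hab.le⟩, ⟨b, right_mem_Icc.2 hab.le⟩,
      fun h => hab.ne (congrArg Subtype.val h)⟩
    refine dense_of_exists_between fun p q hpq => ?_
    obtain ⟨x, hx, hpx, hxq⟩ := ((hFm.countable_not_continuousAt.image
      (Subtype.val : Icc a b → ℝ)).dense_compl ℝ).exists_between (show (p : ℝ) < q from hpq)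
    refine ⟨⟨x, (p.2.1.trans_lt hpx).le, (hxq.trans_le q.2.2).le⟩,
      hcD _ (p.2.1.trans_lt hpx) (hxq.trans_le q.2.2) ?_, hpx, hxq⟩
    by_contra hcon
    exact hx ⟨_, hcon, rfl⟩
  obtain ⟨W, hWo, hyW, hW⟩ :=
    exists_isOpen_forall_mem_m1Ball hab hDd haD hbD (monotone_exitProfile (z := z) hT) hε
  have hpi : Tendsto (fun i => fun t : D => exitProfile z (η i) (t : Icc a b)) L
      (𝓝 fun t : D => exitProfile z y (t : Icc a b)) := tendsto_pi_nhds.2 fun t => t.2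
  filter_upwards [hpi (hWo.mem_nhds hyW), hfin] with i hi hi'
  exact hW _ (monotone_exitProfile hi') hi

lemma tendsto_m1_of_forall_eventually_mem_m1Ball {J : Type*} {L : Filter J}
    {g : J → Cadlag (Icc a b) ℝ} {f : Cadlag (Icc a b) ℝ}
    (h : ∀ ε > 0, ∀ᶠ i in L, g i ∈ m1Ball f ε) : Tendsto g L (@nhds _ (m1Topology a b) f) := by
  let _ := m1Topology a b
  refine tendsto_nhds.2 fun U hU hfU => ?_
  obtain ⟨ε, hε, hεU⟩ := hU f hfU
  exact (h ε hε).mono fun i hi => hεU hi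

end Continuity

/-! ## Convergence of profiles under weak convergence of paths and barriers -/

section Weak

attribute [local instance] j1Topology

variable {d : ℕ}

lemma continuousAt_exitProfile {a b : ℝ} (hab : a < b) {e : Path d × Barrier d}
    (ha : IsRegularLevel (scalarPath e.1 e.2) a) (hb : IsRegularLevel (scalarPath e.1 e.2) b)
    (hsa : IsSeparatedBefore (scalarPath e.1 e.2) a)
    (hsb : IsSeparatedBefore (scalarPath e.1 e.2) b) (z : Cadlag (Icc a b) ℝ) :
    Tendsto (fun e : Path d × Barrier d => exitProfile z (scalarPath e.1 e.2)) (𝓝 e)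
      (@nhds _ (m1Topology a b) (exitProfile z (scalarPath e.1 e.2))) :=
  tendsto_m1_of_forall_eventually_mem_m1Ball fun _ hε =>
    eventually_exitProfile_mem_m1Ball hab
      (fun _ hI v hs => (isOpen_exists_lt_scalarPath hI v).mem_nhds hs)
      (fun _ _ _ _ hc hv h => eventually_forall_scalarPath_lt hc hv h) ha hb hsa hsb z hε

lemma continuousWithinAt_scalarPath (x : Path d) (Φ : Barrier d) (t : ℝ≥0) :
    ContinuousWithinAt (scalarPath x Φ) (Ioi t) t :=
  Φ.continuous.continuousAt.comp_continuousWithinAt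
    (continuousWithinAt_id.prodMk (x.isCadlag t).1)

variable {Ω : ℕ → Type*} {Ω' : Type*} [∀ n, MeasurableSpace (Ω n)] [MeasurableSpace Ω']
  {P : ∀ n, Measure (Ω n)} [∀ n, IsProbabilityMeasure (P n)]
  {P' : Measure Ω'} [IsProbabilityMeasure P']
  {Xn : ∀ n, Ω n → Path d} {Φn : ∀ n, Ω n → Barrier d} {X : Ω' → Path d} {Φ : Ω' → Barrier d}

/-- Never exceeding `u` is a closed condition, null for the limit by regularity, and it contains the
event of never reaching `u`; the portmanteau bound for closed sets applies. -/
lemma tendsto_measure_passageTime_eq_top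
    (h : ConvergesWeakly (pathBarrierTopology d) P P'
      (fun n ω => (Xn n ω, Φn n ω)) (fun ω => (X ω, Φ ω))) {u : ℝ}
    (hu : ∀ᵐ ω ∂P', IsRegularLevel (scalarPath (X ω) (Φ ω)) u) :
    Tendsto (fun n => P n {ω | passageTime (scalarPath (Xn n ω) (Φn n ω)) u = ∞})
      atTop (𝓝 0) := by
  let _ : MeasurableSpace (Path d × Barrier d) := borel _
  have : BorelSpace (Path d × Barrier d) := ⟨rfl⟩
  have hC := (isOpen_exists_lt_scalarPath (d := d) isOpen_univ u).isClosed_compl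
  have h1 := TendstoInDistribution.limsup_measure_le h hC
  have h2 : P' ((fun ω => (X ω, Φ ω)) ⁻¹'
      {e | ∃ s ∈ univ, u < scalarPath e.1 e.2 s}ᶜ) = 0 := by
    refine measure_eq_zero_iff_ae_notMem.2 ?_
    filter_upwards [hu] with ω hω hcon
    obtain ⟨s, -, hs⟩ := hω.exists_lt (lt_add_one _)
    exact hcon ⟨s, trivial, hs⟩
  rw [h2] at h1
  refine tendsto_of_tendsto_of_tendsto_of_le_of_le tendsto_const_nhds
    (tendsto_of_le_liminf_of_limsup_le bot_le h1) (fun _ => bot_le) fun n => ?_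
  refine measure_mono fun ω hω => ?_
  rintro ⟨s, -, hs⟩
  exact absurd hω (ne_top_of_le_ne_top ENNReal.coe_ne_top (passageTime_le_coe (le_of_lt hs)))

/-- Weak convergence of the exit-time profiles. -/
theorem ConvergesWeakly.exitProfile {a b : ℝ} (hab : a < b)
    (h : ConvergesWeakly (pathBarrierTopology d) P P'
      (fun n ω => (Xn n ω, Φn n ω)) (fun ω => (X ω, Φ ω)))
    (ha : ∀ᵐ ω ∂P', IsRegularLevel (scalarPath (X ω) (Φ ω)) a)
    (hb : ∀ᵐ ω ∂P', IsRegularLevel (scalarPath (X ω) (Φ ω)) b)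
    (hs : ∀ᵐ ω ∂P', IsSeparatedBefore (scalarPath (X ω) (Φ ω)) a ∧
      IsSeparatedBefore (scalarPath (X ω) (Φ ω)) b)
    (z : Cadlag (Icc a b) ℝ) :
    ConvergesWeakly (m1Topology a b) P P'
      (fun n ω => exitProfile z (scalarPath (Xn n ω) (Φn n ω)))
      (fun ω => exitProfile z (scalarPath (X ω) (Φ ω))) := by
  let _ : MeasurableSpace (Path d × Barrier d) := borel _
  have : BorelSpace (Path d × Barrier d) := ⟨rfl⟩
  let _ : TopologicalSpace (Cadlag (Icc a b) ℝ) := m1Topology a b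
  let _ : MeasurableSpace (Cadlag (Icc a b) ℝ) := borel _
  have : BorelSpace (Cadlag (Icc a b) ℝ) := ⟨rfl⟩
  refine TendstoInDistribution.comp_of_ae_continuousAt
    (g := fun e : Path d × Barrier d => ExitProfile.exitProfile z (scalarPath e.1 e.2)) h ?_ ?_
  · intro ν _
    exact aemeasurable_exitProfile hab (fun e t => continuousWithinAt_scalarPath e.1 e.2 t)
      (fun I hI v => (isOpen_exists_lt_scalarPath hI v).measurableSet) z
  · filter_upwards [ha, hb, hs] with ω h1 h2 h3
    exact continuousAt_exitProfile hab (e := (X ω, Φ ω)) h1 h2 h3.1 h3.2 z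

end Weak

/-! ## The explicit paths -/

section Example

lemma stepPath_le_of_lt_two {t : ℝ≥0} (h : t < 2) : stepPath t ≤ 1 / 2 := by
  rw [stepPath]
  split_ifs <;> norm_num

lemma stepPath_of_lt_one {t : ℝ≥0} (h : t < 1) : stepPath t = 0 := if_pos h

lemma stepPath_one : stepPath 1 = 1 / 2 := by
  rw [stepPath, if_neg (lt_irrefl _), if_pos one_lt_two]

lemma stepPath_two : stepPath 2 = 1 := by
  rw [stepPath, if_neg (by norm_num), if_neg (lt_irrefl _)]

lemma passageTime_stepPath_of_le {u : ℝ} (h0 : 0 < u) (h1 : u ≤ 1 / 2) :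
    passageTime stepPath u = 1 := by
  refine le_antisymm ?_ ?_
  · exact_mod_cast passageTime_le_coe (s := 1) (stepPath_one ▸ h1)
  · exact_mod_cast coe_le_passageTime (c := 1) fun s hs => (stepPath_of_lt_one hs).trans_lt h0

lemma passageTime_stepPath_of_lt {u : ℝ} (h0 : 1 / 2 < u) (h1 : u ≤ 1) :
    passageTime stepPath u = 2 := by
  refine le_antisymm ?_ ?_
  · exact_mod_cast passageTime_le_coe (s := 2) (stepPath_two ▸ h1)
  · exact_mod_cast coe_le_passageTime (c := 2)
      fun s hs => (stepPath_le_of_lt_two hs).trans_lt h0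

lemma abs_stairPath_sub_stepPath_le (n : ℕ) (t : ℝ≥0) :
    |stairPath n t - stepPath t| ≤ 1 / (n : ℝ) := by
  have hn : (0 : ℝ) ≤ 1 / n := by positivity
  rw [stairPath, stepPath]
  split_ifs with h1 h2
  · simp
  · have ht1 : (1 : ℝ) ≤ t := by exact_mod_cast not_lt.1 h1
    have ht2 : (t : ℝ) < 2 := by exact_mod_cast h2
    rw [add_sub_cancel_left, abs_of_nonneg (by positivity)]
    rcases n.eq_zero_or_pos with rfl | hpos
    · simp
    have hn' : (0 : ℝ) < n := by exact_mod_cast hpos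
    have hfl : (⌊(n : ℝ) * ((t : ℝ) - 1)⌋₊ : ℝ) ≤ n * (t - 1) :=
      Nat.floor_le (mul_nonneg hn'.le (by linarith))
    rw [div_le_div_iff₀ (by positivity) hn']
    nlinarith
  · simp

lemma tendstoUniformly_stairPath : TendstoUniformly stairPath stepPath atTop := by
  rw [Metric.tendstoUniformly_iff]
  intro ε hε
  filter_upwards [(tendsto_one_div_atTop_nhds_zero_nat (𝕜 := ℝ)).eventually_lt_const hε] with n hn t
  rw [dist_comm, Real.dist_eq]
  exact (abs_stairPath_sub_stepPath_le n t).trans_lt hn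

/-- The level $1/2$ is not regular for the limit path, but the deterministic criterion asks for
regularity only at $1/4$ and $3/4$. -/
lemma tendsto_m1_exitProfile_stairPath (z : Cadlag (Icc (1 / 4 : ℝ) (3 / 4)) ℝ) :
    Tendsto (fun n => exitProfile z (stairPath n)) atTop
      (@nhds _ (m1Topology (1 / 4) (3 / 4)) (exitProfile z stepPath)) := by
  have hu := Metric.tendstoUniformly_iff.1 tendstoUniformly_stairPath
  have h1 := passageTime_stepPath_of_le (u := 1 / 4) (by norm_num) (by norm_num)
  have h2 := passageTime_stepPath_of_lt (u := 3 / 4) (by norm_num) (by norm_num)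
  refine tendsto_m1_of_forall_eventually_mem_m1Ball fun ε hε =>
    eventually_exitProfile_mem_m1Ball (by norm_num) ?_ ?_ ?_ ?_ ?_ ?_ z hε
  · rintro I - v ⟨s, hsI, hs⟩
    filter_upwards [hu _ (sub_pos.2 hs)] with n hn
    refine ⟨s, hsI, ?_⟩
    have := (abs_lt.1 (Real.dist_eq _ _ ▸ hn s)).2
    linarith
  · intro c c' v v' hc hv h
    filter_upwards [hu _ (sub_pos.2 hv)] with n hn s hs
    have := (abs_lt.1 (Real.dist_eq _ _ ▸ hn s)).1
    have := h s (hs.trans hc.le)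
    linarith
  · refine ⟨by rw [h1]; exact ENNReal.one_lt_top, fun ε _ => ⟨1, ?_, ?_, ?_⟩⟩
    · rw [h1]; exact le_rfl
    · rw [h1]; exact le_self_add
    · rw [stepPath_one]; norm_num
  · refine ⟨by rw [h2]; exact ENNReal.ofNat_lt_top, fun ε _ => ⟨2, ?_, ?_, ?_⟩⟩
    · rw [h2]; exact le_rfl
    · rw [h2]; exact le_self_add
    · rw [stepPath_two]; norm_num
  · intro T hT
    rw [h1] at hT
    have hT' : T < 1 := by exact_mod_cast hT
    exact ⟨0, by norm_num, fun s hs => (stepPath_of_lt_one (hs.trans_lt hT')).le⟩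
  · intro T hT
    rw [h2] at hT
    have hT' : T < 2 := by exact_mod_cast hT
    exact ⟨1 / 2, by norm_num, fun s hs => stepPath_le_of_lt_two (hs.trans_lt hT')⟩

lemma exitProfile_stepPath_eq_or (z : Cadlag (Icc (1 / 4 : ℝ) (3 / 4)) ℝ)
    (u : Icc (1 / 4 : ℝ) (3 / 4)) :
    exitProfile z stepPath u = 1 ∨ exitProfile z stepPath u = 2 := by
  have h2 := passageTime_stepPath_of_lt (u := 3 / 4) (by norm_num) (by norm_num)
  have hfin : passageTime stepPath (3 / 4) ≠ ∞ := by rw [h2]; exact ENNReal.ofNat_ne_top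
  have hF : ∀ u : Icc (1 / 4 : ℝ) (3 / 4),
      (passageTime stepPath u).toReal ∈ ({1, 2} : Set ℝ) := by
    intro u
    rcases le_or_gt (u : ℝ) (1 / 2) with h | h
    · rw [passageTime_stepPath_of_le (by linarith [u.2.1]) h]; simp
    · rw [passageTime_stepPath_of_lt h (by linarith [u.2.2])]; simp
  rw [exitProfile_apply hfin]
  change Function.rightLim _ u ∈ ({1, 2} : Set ℝ)
  rcases eq_or_neBot (𝓝[>] u) with h | h
  · rw [rightLim_eq_of_eq_bot _ h]
    exact hF u
  · exact (toFinite ({1, 2} : Set ℝ)).isClosed.mem_of_tendsto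
      ((monotone_toReal_passageTime hfin).tendsto_rightLim u) (Eventually.of_forall hF)

/-- The profiles of the stair paths take values strictly between the two values of the limit. -/
lemma exists_exitProfile_stairPath_mem (z : Cadlag (Icc (1 / 4 : ℝ) (3 / 4)) ℝ) {n : ℕ}
    (hn : 8 ≤ n) : ∃ u, exitProfile z (stairPath n) u ∈ Icc (13 / 10 : ℝ) (3 / 2) := by
  have hn' : (8 : ℝ) ≤ n := by exact_mod_cast hn
  have hn2 : (0 : ℝ) < (n : ℝ) ^ 2 := by positivity
  -- `m` indexes the stair at time $3/2$, and the chosen level lies half a step below it, so it is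
  -- crossed strictly by then. Before $13/10$ the index is at most $3n/10$, which is below $m-1/2$
  -- once $n\ge 8$.
  set m : ℝ := (⌊(n : ℝ) * (1 / 2)⌋₊ : ℝ) with hm
  have hm1 : m ≤ n / 2 := by
    have := Nat.floor_le (a := (n : ℝ) * (1 / 2)) (by positivity)
    linarith
  have hm2 : n / 2 - 1 < m := by
    have := Nat.lt_floor_add_one ((n : ℝ) * (1 / 2))
    linarith
  have hsmall : m / (n : ℝ) ^ 2 ≤ 1 / 4 := by
    rw [div_le_iff₀ hn2]; nlinarith
  have hlt : (m - 1 / 2) / (n : ℝ) ^ 2 < m / (n : ℝ) ^ 2 :=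
    div_lt_div_of_pos_right (by linarith) hn2
  have hpos : 0 ≤ (m - 1 / 2) / (n : ℝ) ^ 2 := div_nonneg (by linarith) hn2.le
  have hfin : passageTime (stairPath n) (3 / 4) ≠ ∞ := by
    refine ne_top_of_le_ne_top ENNReal.coe_ne_top (passageTime_le_coe (s := 2) ?_)
    rw [stairPath, if_neg (by norm_num), if_neg (lt_irrefl _)]
    norm_num
  set u : Icc (1 / 4 : ℝ) (3 / 4) :=
    ⟨1 / 2 + (m - 1 / 2) / (n : ℝ) ^ 2, by linarith, by linarith⟩ with hu
  have hut : passageTime (stairPath n) u ≠ ∞ :=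
    ne_top_of_le_ne_top hfin (passageTime_mono _ u.2.2)
  refine ⟨u, le_trans ?_ (le_exitProfile hfin u), ?_⟩
  · have h := ENNReal.toReal_mono hut (coe_le_passageTime (c := 13 / 10) fun s hs => ?_)
    · simpa using h
    · have hs' : (s : ℝ) < 13 / 10 := by exact_mod_cast hs
      have hs2 : s < 2 := by
        have : (s : ℝ) < (2 : ℝ≥0) := by push_cast; linarith
        exact_mod_cast this
      rw [stairPath]
      simp only [hu]
      split_ifs with h1
      · linarith
      · have h1' : (1 : ℝ) ≤ s := by exact_mod_cast not_lt.1 h1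
        have hfl : (⌊(n : ℝ) * ((s : ℝ) - 1)⌋₊ : ℝ) ≤ n * (s - 1) :=
          Nat.floor_le (mul_nonneg (by linarith) (by linarith))
        have : (⌊(n : ℝ) * ((s : ℝ) - 1)⌋₊ : ℝ) / (n : ℝ) ^ 2 < (m - 1 / 2) / (n : ℝ) ^ 2 :=
          div_lt_div_of_pos_right (by nlinarith) hn2
        linarith
  · have h : (u : ℝ) < stairPath n (3 / 2) := by
      have h1 : ¬ (3 / 2 : ℝ≥0) < 1 := by
        rw [not_lt, ← NNReal.coe_le_coe]; norm_num
      have h2 : (3 / 2 : ℝ≥0) < 2 := by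
        rw [← NNReal.coe_lt_coe]; norm_num
      rw [stairPath, if_neg h1, if_pos h2]
      have : (((3 / 2 : ℝ≥0) : ℝ) - 1) = 1 / 2 := by push_cast; norm_num
      rw [this]
      simp only [hu]
      linarith
    simpa using exitProfile_le (z := z) hfin h

/-- A `J₁` neighbourhood whose range condition is uniform over the whole compact interval. -/
lemma isOpen_j1_setOf_dist_le {a b : ℝ} (f : Cadlag (Icc a b) ℝ) (ε : ℝ) :
    IsOpen[j1Topology (Icc a b) ℝ] {h : Cadlag (Icc a b) ℝ |
      ∃ δ < ε, ∃ l : Icc a b ≃o Icc a b, ∀ t, dist (h (l t)) (f t) ≤ δ} := by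
  rintro h ⟨δ, hδ, l, hl⟩
  -- The bound `δ < ε`, uniform in `t`, leaves slack; half of it is spent on the perturbation.
  refine ⟨univ, isCompact_univ, (ε - δ) / 2, half_pos (sub_pos.2 hδ), ?_⟩
  rintro w ⟨k, hk⟩
  refine ⟨δ + (ε - δ) / 2, by linarith, l.trans k, fun t => ?_⟩
  have h1 := (hk (l t) trivial).2
  have h2 := dist_triangle (w (k (l t))) (h (l t)) (f t)
  have h3 := hl t
  simp only [OrderIso.trans_apply]
  linarith

/-- A change of levels is onto, so $J_1$-closeness would put every value of the stair profile within
$1/4$ of $1$ or $2$; a value in $[13/10,3/2]$ is not. -/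
lemma not_tendsto_j1_exitProfile_stairPath (z : Cadlag (Icc (1 / 4 : ℝ) (3 / 4)) ℝ) :
    ¬ Tendsto (fun n => exitProfile z (stairPath n)) atTop
      (@nhds _ (j1Topology (Icc (1 / 4 : ℝ) (3 / 4)) ℝ) (exitProfile z stepPath)) := by
  let _ := j1Topology (Icc (1 / 4 : ℝ) (3 / 4)) ℝ
  intro hcon
  have hV := (isOpen_j1_setOf_dist_le (exitProfile z stepPath) (1 / 4)).mem_nhds
    ⟨0, by norm_num, OrderIso.refl _, fun t => (dist_self _).le⟩
  obtain ⟨n, ⟨δ, hδ, l, hl⟩, hn⟩ := ((hcon.eventually hV).and (eventually_ge_atTop 8)).exists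
  obtain ⟨u, hu1, hu2⟩ := exists_exitProfile_stairPath_mem z hn
  have h := hl (l.symm u)
  rw [OrderIso.apply_symm_apply, Real.dist_eq, abs_le] at h
  rcases exitProfile_stepPath_eq_or z (l.symm u) with h' | h' <;> rw [h'] at h <;> linarith [h.1, h.2]

end Example

end ExitProfile

open ExitProfile in
theorem theorem4p1 :
    (∀ (d : ℕ) (u₀ u₁ : ℚ) (_ : u₀ < u₁)
      (Ω : ℕ → Type*) (Ω' : Type*) [∀ n, MeasurableSpace (Ω n)] [MeasurableSpace Ω']
      (P : ∀ n, Measure (Ω n)) [∀ n, IsProbabilityMeasure (P n)]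
      (P' : Measure Ω') [IsProbabilityMeasure P']
      (Xn : ∀ n, Ω n → Path d) (Φn : ∀ n, Ω n → Barrier d)
      (X : Ω' → Path d) (Φ : Ω' → Barrier d)
      -- joint weak convergence of paths and barriers
      (_ : ConvergesWeakly (pathBarrierTopology d) P P'
        (fun n ω => (Xn n ω, Φn n ω)) (fun ω => (X ω, Φ ω)))
      -- (i) the top level is a.s. reached
      (_ : ∀ᵐ ω ∂P', passageTime (scalarPath (X ω) (Φ ω)) u₁ < ∞)
      -- (ii) a.s. every rational level is regular
      (_ : ∀ᵐ ω ∂P', ∀ q : ℚ, u₀ ≤ q → q ≤ u₁ → IsRegularLevel (scalarPath (X ω) (Φ ω)) q)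
      -- (iii) a.s. strict separation from the two end levels before their first passage
      (_ : ∀ᵐ ω ∂P', IsSeparatedBefore (scalarPath (X ω) (Φ ω)) u₀ ∧
        IsSeparatedBefore (scalarPath (X ω) (Φ ω)) u₁),
      Tendsto (fun n => P n {ω | passageTime (scalarPath (Xn n ω) (Φn n ω)) u₁ = ∞})
        atTop (𝓝 0) ∧
      ∀ z : Cadlag (Icc (u₀ : ℝ) (u₁ : ℝ)) ℝ,
        ConvergesWeakly (m1Topology (u₀ : ℝ) (u₁ : ℝ)) P P'
          (fun n ω => exitProfile z (scalarPath (Xn n ω) (Φn n ω)))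
          (fun ω => exitProfile z (scalarPath (X ω) (Φ ω)))) ∧
    -- explicit scalar paths: uniform convergence, `M₁` but not `J₁` convergence of the profiles
    (TendstoUniformly stairPath stepPath atTop ∧
      ∀ z : Cadlag (Icc (1 / 4 : ℝ) (3 / 4)) ℝ,
        Tendsto (fun n => exitProfile z (stairPath n)) atTop
          (@nhds _ (m1Topology (1 / 4) (3 / 4)) (exitProfile z stepPath)) ∧
        ¬ Tendsto (fun n => exitProfile z (stairPath n)) atTop
          (@nhds _ (j1Topology (Icc (1 / 4 : ℝ) (3 / 4)) ℝ) (exitProfile z stepPath))) := by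
  refine ⟨?_, tendstoUniformly_stairPath, fun z =>
    ⟨tendsto_m1_exitProfile_stairPath z, not_tendsto_j1_exitProfile_stairPath z⟩⟩
  intro d u₀ u₁ hu Ω Ω' _ _ P _ P' _ Xn Φn X Φ hconv _ hreg hsep
  have h₀ : ∀ᵐ ω ∂P', IsRegularLevel (scalarPath (X ω) (Φ ω)) u₀ :=
    hreg.mono fun ω h => h u₀ le_rfl hu.le
  have h₁ : ∀ᵐ ω ∂P', IsRegularLevel (scalarPath (X ω) (Φ ω)) u₁ :=
    hreg.mono fun ω h => h u₁ hu.le le_rfl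
  exact ⟨tendsto_measure_passageTime_eq_top hconv h₁, fun z =>
    hconv.exitProfile (by exact_mod_cast hu) h₀ h₁ hsep z⟩
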